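/- Let $G$ be an $n$-vertex interval graph (the intersection graph of finitely many nonempty closed real intervals) and let $k\ge 1$. For an independent set $A$ and a pair $(u,v)$ with $u\in A$, $v\notin A$, $uv\in E(G)$ and $(A\setminus\{u\})\cup\{v\}$ independent, applying $(u,v)$ to $A$ (a move) yields $(A\setminus\{u\})\cup\{v\}$; a reconfiguration sequence from $A$ to $B$ is a finite list of moves which, applied successively, turns $A$ into $B$, and its length is the number of moves. $R_k(G)$ is the graph on the independent sets of size $k$ of $G$ in which two sets are adjacent if and only if one arises from the other by one move. $G$ has an interval representation in which all $2n$ endpoints are distinct. Fix any such representation; let $\le_{\rm left}$ and $\le_{\rm right}$ be the orders of the vertices by left and by right endpoints, and write an independent set $A$ of size $k$ as $(\pi_1(A),\dots,\pi_k(A))$ in its order on the line. For a nonempty family $\mathcal C$ of independent sets of size $k$ put $\mathrm{ex}_j(\mathcal C,\mathrm{left})=\min_{\le_{\rm right}}\{\pi_j(A):A\in\mathcal C\}$ and $\mathrm{ex}_j(\mathcal C,\mathrm{right})=\max_{\le_{\rm left}}\{\pi_j(A):A\in\mathcal C\}$; the $p$-extreme set of $\mathcal C$ is $\{\mathrm{ex}_j(\mathcal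 C,\mathrm{left}):1\le j\le p\}\cup\{\mathrm{ex}_j(\mathcal C,\mathrm{right}):p<j\le k\}$. Consider the following procedures, where $H$ is an induced subgraph of $G$, $N[v]$ is the closed neighbourhood of $v$, and shortest paths are chosen by an arbitrary fixed rule. * $\mathrm{PushTokenLeft}(H,u)$ (respectively $\mathrm{PushTokenRight}(H,u)$): let $w$ be the $\le_{\rm right}$-minimum (respectively $\le_{\rm left}$-maximum) vertex reachable from $u$ in $H$, and let $(v_0,\dots,v_m)$ be a shortest path from $u$ to $w$ in $H$; return $w$ and the list $((v_0,v_1),\dots,(v_{m-1},v_m))$. * $\mathrm{PushApart}(H,(a,b))$: start with the empty list $S$; repeat $[a,S_1]:=\mathrm{PushTokenLeft}(H\setminus N[b],a)$, $[b,S_2]:=\mathrm{PushTokenRight}(H\setminus N[a],b)$, append $S_1$ and then $S_2$ to $S$, until both $S_1$ and $S_2$ are empty; return $(a,b)$ and $S$. * $\mathrm{Reconfigure}(G,k,A)$: set $a_i:=\mathrm{lext}_i:=\mathrm{rext}_i:=\pi_i(A)$ for $1\le i\le k$, $j:=1$, $S:=()$. While $j<k$: set $[(a_j,a_{j+1}),S']:=\mathrm{PushApart}(G\setminus\bigcup_{i\ne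 j,j+1}N[a_i],(a_j,a_{j+1}))$ and append $S'$ to $S$; let $\gamma:=1$; if $(a_j,a_{j+1})\ne(\mathrm{lext}_j,\mathrm{rext}_{j+1})$, then set $\mathrm{lext}_j:=a_j$, $\mathrm{rext}_{j+1}:=a_{j+1}$ and, if $j>1$, $\gamma:=-1$; set $j:=j+\gamma$. Return $(a_1,\dots,a_k)$ and $S$. Then: 1. If $k\ge2$ and $A$ is an independent set of size $k$ in $G$, then $\mathrm{Reconfigure}(G,k,A)$ terminates and returns the $(k-1)$-extreme set of the component of $A$ in $R_k(G)$, listed in its order on the line (in particular this set is an independent set of size $k$), together with a reconfiguration sequence from $A$ to this set of length at most $8kn^2+2kn=O(kn^2)$. 2. Two independent sets $A,B$ of size $k$ lie in the same component of $R_k(G)$ if and only if the $(k-1)$-extreme sets of their components coincide. 3. If $A,B$ lie in the same component of $R_k(G)$, then there is a reconfiguration sequence from $A$ to $B$ of length at most $2(8kn^2+2kn)=O(kn^2)$. -/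

import Mathlib

namespace TokenSliding

noncomputable section

/-- A representation of `G` as an intersection graph of nonempty closed real intervals. -/
structure IntervalRep {V : Type*} (G : SimpleGraph V) where
  left : V → ℝ
  right : V → ℝ
  left_le_right : ∀ v, left v ≤ right v
  adj_iff : ∀ u v, G.Adj u v ↔
    u ≠ v ∧ (Set.Icc (left u) (right u) ∩ Set.Icc (left v) (right v)).Nonempty

/-- `G` is an interval graph. -/
def IsIntervalGraph {V : Type*} (G : SimpleGraph V) : Prop := Nonempty (IntervalRep G)

/-- An interval representation in which all the endpoints (two for each vertex) are distinct. -/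
structure DistinctRep {V : Type*} (G : SimpleGraph V) extends IntervalRep G where
  endpoints_injective : Function.Injective (Sum.elim left right)

/-- The independent sets of size `k`. -/
abbrev IndepSets {V : Type*} (G : SimpleGraph V) (k : ℕ) : Type _ :=
  {A : Finset V // G.IsNIndepSet k A}

/-- The token-sliding graph `R_k(G)`: two independent sets of size `k` are adjacent when one
arises from the other by moving one token along an edge of `G`. -/
def reconfGraph {V : Type*} [DecidableEq V] (G : SimpleGraph V) (k : ℕ) :
    SimpleGraph (IndepSets G k) where
  Adj A B := ∃ u v, A.1 \ B.1 = {u} ∧ B.1 \ A.1 = {v} ∧ G.Adj u v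
  symm := ⟨fun _ _ ⟨u, v, hu, hv, h⟩ => ⟨v, u, hv, hu, h.symm⟩⟩
  loopless := ⟨fun _ ⟨u, v, hu, _, _⟩ => by simp at hu⟩

/-- The component of `A` in `R_k(G)`, as a family of independent sets. -/
def component {V : Type*} [DecidableEq V] (G : SimpleGraph V) {k : ℕ} (A : IndepSets G k) :
    Set (IndepSets G k) :=
  ((reconfGraph G k).connectedComponentMk A).supp

/-- `IsReconfSeq G A S B`: applying the moves `(u, v)` of `S` one after the other to `A`, where
`(u, v)` slides the token on `u` along an edge to the unoccupied vertex `v`, all the sets after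
each move are independent, and the last set is `B`. -/
def IsReconfSeq {V : Type*} [DecidableEq V] (G : SimpleGraph V) :
    Finset V → List (V × V) → Finset V → Prop
  | A, [], B => A = B
  | A, (u, v) :: S, B => u ∈ A ∧ v ∉ A ∧ G.Adj u v ∧
      G.IsIndepSet (insert v (A.erase u) : Finset V) ∧
      IsReconfSeq G (insert v (A.erase u)) S B

/-- The closed neighbourhood `N[v]`. -/
def closedNbhd {V : Type*} (G : SimpleGraph V) (v : V) : Set V := insert v (G.neighborSet v)

/-- The vertices reachable from `u` in the subgraph of `G` induced on `U`
(the empty set if `u ∉ U`). -/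
def reachSet {V : Type*} (G : SimpleGraph V) (U : Set V) (u : V) : Set V :=
  {v | ∃ (hu : u ∈ U) (hv : v ∈ U), (G.induce U).Reachable ⟨u, hu⟩ ⟨v, hv⟩}

/-- `p` is the vertex sequence of a shortest path from `u` to `w` in the subgraph of `G`
induced on `U`. -/
def IsShortestPath {V : Type*} (G : SimpleGraph V) (U : Set V) (u w : V) (p : List V) : Prop :=
  ∃ (hu : u ∈ U) (hw : w ∈ U) (q : (G.induce U).Walk ⟨u, hu⟩ ⟨w, hw⟩),
    q.length = (G.induce U).dist ⟨u, hu⟩ ⟨w, hw⟩ ∧ q.support.map Subtype.val = p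

/-- A rule that picks a shortest path between any two vertices that are connected in an
induced subgraph. -/
structure ShortestPathRule {V : Type*} (G : SimpleGraph V) where
  path : Set V → V → V → List V
  isShortest : ∀ U u w, w ∈ reachSet G U u → IsShortestPath G U u w (path U u w)

instance {V : Type*} (G : SimpleGraph V) : Nonempty (ShortestPathRule G) := by
  have h : ∀ (U : Set V) (u w : V), ∃ p : List V,
      w ∈ reachSet G U u → IsShortestPath G U u w p := by
    intro U u w
    by_cases hw : w ∈ reachSet G U u
    · obtain ⟨h1, h2, h3⟩ := hw
      obtain ⟨q, hq⟩ := h3.exists_walk_length_eq_dist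
      exact ⟨_, fun _ => ⟨h1, h2, q, hq, rfl⟩⟩
    · exact ⟨[], fun h => absurd h hw⟩
  choose p hp using h
  exact ⟨⟨p, hp⟩⟩

/-- The moves of a token along the path with vertex sequence `p`. -/
def pathMoves {V : Type*} (p : List V) : List (V × V) := p.zip p.tail

/-- The data held by the variables of `Reconfigure`; the index `j` counts from `0`. -/
structure State (V : Type*) (k : ℕ) where
  a : Fin k → V
  lext : Fin k → V
  rext : Fin k → V
  j : ℕ
  S : List (V × V)

namespace DistinctRep

variable {V : Type*} {G : SimpleGraph V}

/-- The order of the vertices along the left endpoints. -/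
abbrev leftOrder (R : DistinctRep G) : LinearOrder V :=
  LinearOrder.lift' R.left fun _ _ h => Sum.inl_injective (R.endpoints_injective h)

/-- The members of `A` listed along the left endpoints, which for an independent set is its
order on the line; `R.proj A i` is the member at position `i` (counted from `0`). -/
def proj (R : DistinctRep G) {k : ℕ} (A : IndepSets G k) (i : Fin k) : V :=
  @Finset.orderEmbOfFin V R.leftOrder A.1 k A.2.card_eq i

/-- `v` is `ex_j(C, left)`: the member of `{π_j(A) : A ∈ C}` with the least right endpoint. -/
def IsExLeft (R : DistinctRep G) {k : ℕ} (C : Set (IndepSets G k)) (j : Fin k) (v : V) : Prop :=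
  (∃ A ∈ C, R.proj A j = v) ∧ ∀ A ∈ C, R.right v ≤ R.right (R.proj A j)

/-- `v` is `ex_j(C, right)`: the member of `{π_j(A) : A ∈ C}` with the greatest left endpoint. -/
def IsExRight (R : DistinctRep G) {k : ℕ} (C : Set (IndepSets G k)) (j : Fin k) (v : V) : Prop :=
  (∃ A ∈ C, R.proj A j = v) ∧ ∀ A ∈ C, R.left (R.proj A j) ≤ R.left v

/-- The `p`-extreme set of the family `C`: the left extremes of the first `p` positions
together with the right extremes of the others. -/
def extremeSet (R : DistinctRep G) {k : ℕ} (p : ℕ) (C : Set (IndepSets G k)) : Set V :=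
  {v | ∃ j : Fin k, (j.1 < p ∧ R.IsExLeft C j v) ∨ (p ≤ j.1 ∧ R.IsExRight C j v)}

variable [Finite V]

/-- The member of `s` with the least right endpoint. -/
def minRight (R : DistinctRep G) (s : Set V) (hs : s.Nonempty) : V :=
  (Set.exists_min_image s R.right s.toFinite hs).choose

/-- The member of `s` with the greatest left endpoint. -/
def maxLeft (R : DistinctRep G) (s : Set V) (hs : s.Nonempty) : V :=
  (Set.exists_max_image s R.left s.toFinite hs).choose

/-- `PushTokenLeft(H, u)` for the subgraph `H` of `G` induced on `U`; it is undefined if `u` is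
not a vertex of `H`. -/
def pushTokenLeft (R : DistinctRep G) (P : ShortestPathRule G) (U : Set V) (u : V) :
    Part (V × List (V × V)) :=
  Part.assert (reachSet G U u).Nonempty fun hs =>
    let w := R.minRight (reachSet G U u) hs
    Part.some (w, pathMoves (P.path U u w))

/-- `PushTokenRight(H, u)` for the subgraph `H` of `G` induced on `U`; it is undefined if `u` is
not a vertex of `H`. -/
def pushTokenRight (R : DistinctRep G) (P : ShortestPathRule G) (U : Set V) (u : V) :
    Part (V × List (V × V)) :=
  Part.assert (reachSet G U u).Nonempty fun hs =>
    let w := R.maxLeft (reachSet G U u) hs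
    Part.some (w, pathMoves (P.path U u w))

variable [DecidableEq V]

/-- One pass through the loop of `PushApart`, with the variables `(a, b, S)`: `Sum.inl` means
that the loop ends with these values, `Sum.inr` that it goes on with them. -/
def pushApartBody (R : DistinctRep G) (P : ShortestPathRule G) (U : Set V) :
    (V × V × List (V × V)) →. (V × V × List (V × V)) ⊕ (V × V × List (V × V)) :=
  fun x =>
    (R.pushTokenLeft P (U \ closedNbhd G x.2.1) x.1).bind fun y =>
    (R.pushTokenRight P (U \ closedNbhd G y.1) x.2.1).bind fun z =>
      if y.2 ++ z.2 ≠ [] then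
        Part.some (Sum.inr (y.1, z.1, x.2.2 ++ y.2 ++ z.2))
      else
        Part.some (Sum.inl (y.1, z.1, x.2.2 ++ y.2 ++ z.2))

/-- `PushApart(H, (a, b))` for the subgraph `H` of `G` induced on `U`. -/
def pushApart (R : DistinctRep G) (P : ShortestPathRule G) (U : Set V) (a b : V) :
    Part (V × V × List (V × V)) :=
  (R.pushApartBody P U).fix (a, b, [])

/-- One pass through the loop of `Reconfigure`: `Sum.inl` means that the loop has ended with this
result, `Sum.inr` that it goes on with these values of the variables. -/
def reconfigureBody (R : DistinctRep G) (P : ShortestPathRule G) (k : ℕ) :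
    State V k →. ((Fin k → V) × List (V × V)) ⊕ State V k :=
  fun s =>
    if h : s.j + 1 < k then
      let p : Fin k := ⟨s.j, by omega⟩
      let q : Fin k := ⟨s.j + 1, h⟩
      (R.pushApart P {v | ∀ i, i ≠ p → i ≠ q → v ∉ closedNbhd G (s.a i)} (s.a p) (s.a q)).bind
        fun y =>
          let a' := Function.update (Function.update s.a p y.1) q y.2.1
          let S' := s.S ++ y.2.2
          if (y.1, y.2.1) ≠ (s.lext p, s.rext q) then
            Part.some (Sum.inr
              { a := a'
                lext := Function.update s.lext p y.1
                rext := Function.update s.rext q y.2.1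
                j := if 0 < s.j then s.j - 1 else s.j + 1
                S := S' })
          else
            Part.some (Sum.inr { a := a', lext := s.lext, rext := s.rext, j := s.j + 1, S := S' })
    else
      Part.some (Sum.inl (s.a, s.S))

/-- `Reconfigure(G, k, A)`; an execution that does not terminate has no value. -/
def reconfigure (R : DistinctRep G) (P : ShortestPathRule G) {k : ℕ} (A : IndepSets G k) :
    Part ((Fin k → V) × List (V × V)) :=
  (R.reconfigureBody P k).fix { a := R.proj A, lext := R.proj A, rext := R.proj A, j := 0, S := [] }

end DistinctRep

end

end TokenSliding

namespace TokenSliding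

noncomputable section

/-! ### Reachability in induced subgraphs -/

section Reach

variable {V : Type*} {G : SimpleGraph V}

/-! A sliding token cannot jump over another, so an independent set is a configuration sorted on the
line, and a component is described by how far each position can travel. The algorithm keeps a left
record `l i` and a right record `r i` for each position. Its invariant is `Linked`: `r i` is
reachable from `l i` strictly between `l (i-1)` and `r (i+1)`. Improving a record only enlarges
these regions, so the invariant survives, and it makes every configuration "`l` on the first `m`
positions, `r` on the rest" independent.

Correctness: suppose that no `l i` except perhaps the last, and no `r i` except perhaps the first,
can be improved inside its region; these are exactly the records that bound regions. Then every
position is trapped in its region throughout the component (`proj_mem_of_reachable`), so the records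
are the true extremes, and the final configuration, `mixed l r (k - 1)`, is the `(k-1)`-extreme set.
Components with the same extreme set therefore share a member. For `k = 1` this is checked directly.

Length: the potential Φ counts the vertices that beat a record; it is at most 2kn. A push makes at
most n moves, and a nonempty push of a token standing at its record lowers Φ. Only in the first pass
of a `PushApart` can a token start away from its record, and then only one of the two, which costs n
unpaid moves. The weight 3Φ + (k - 1 - j) decreases in every pass of `Reconfigure`, and n times its
decrease pays for the moves of the pass. -/

theorem mem_reachSet_iff {U : Set V} {u v : V} :
    v ∈ reachSet G U u ↔
      u ∈ U ∧ Relation.ReflTransGen (fun x y => G.Adj x y ∧ y ∈ U) u v := by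
  constructor
  · rintro ⟨hu, hv, h⟩
    refine ⟨hu, ?_⟩
    obtain ⟨w⟩ := h
    suffices H : ∀ (x y : U), (G.induce U).Walk x y →
        Relation.ReflTransGen (fun x y => G.Adj x y ∧ y ∈ U) x.1 y.1 from H _ _ w
    intro x y w
    induction w with
    | nil => exact .refl
    | cons h _ ih => exact .head ⟨h, Subtype.prop _⟩ ih
  · rintro ⟨hu, h⟩
    induction h with
    | refl => exact ⟨hu, hu, .refl _⟩
    | tail _ hbc ih =>
      obtain ⟨h1, h2, h3⟩ := ih
      exact ⟨h1, hbc.2, h3.trans (SimpleGraph.Adj.reachable (by exact hbc.1))⟩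

theorem self_mem_reachSet {U : Set V} {u : V} (h : u ∈ U) : u ∈ reachSet G U u :=
  ⟨h, h, .refl _⟩

theorem mem_of_mem_reachSet {U : Set V} {u v : V} (h : v ∈ reachSet G U u) : v ∈ U :=
  h.choose_spec.choose

theorem source_mem_of_mem_reachSet {U : Set V} {u v : V} (h : v ∈ reachSet G U u) : u ∈ U :=
  h.choose

theorem reachSet_symm {U : Set V} {u v : V} (h : v ∈ reachSet G U u) : u ∈ reachSet G U v := by
  obtain ⟨h1, h2, h3⟩ := h
  exact ⟨h2, h1, h3.symm⟩

theorem reachSet_trans {U : Set V} {u v w : V} (h : v ∈ reachSet G U u)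
    (h' : w ∈ reachSet G U v) : w ∈ reachSet G U u := by
  obtain ⟨h1, h2, h3⟩ := h
  obtain ⟨_, h5, h6⟩ := h'
  exact ⟨h1, h5, h3.trans h6⟩

theorem reachSet_step {U : Set V} {u v w : V} (h : v ∈ reachSet G U u) (ha : G.Adj v w)
    (hw : w ∈ U) : w ∈ reachSet G U u := by
  rw [mem_reachSet_iff] at h ⊢
  exact ⟨h.1, h.2.tail ⟨ha, hw⟩⟩

theorem reachSet_induction {U : Set V} {u : V} {p : V → Prop} (hu : p u)
    (hs : ∀ v ∈ U, ∀ w ∈ U, G.Adj v w → p v → p w) {v : V} (hv : v ∈ reachSet G U u) : p v := by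
  obtain ⟨h0, h⟩ := mem_reachSet_iff.1 hv
  have : v ∈ U ∧ p v := by
    clear hv
    induction h with
    | refl => exact ⟨h0, hu⟩
    | tail _ hbc ih => exact ⟨hbc.2, hs _ ih.1 _ hbc.2 hbc.1 ih.2⟩
  exact this.2

/-- Only the vertices actually reached need to lie in `W`. This transfers a push found in the graph
avoiding the other tokens to the region between two records. -/
theorem reachSet_subset_reachSet {U W : Set V} {u : V} (h : reachSet G U u ⊆ W) :
    reachSet G U u ⊆ reachSet G W u := by
  intro v hv
  have h0 := source_mem_of_mem_reachSet hv
  have : v ∈ reachSet G U u ∧ v ∈ reachSet G W u := by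
    refine reachSet_induction (p := fun v => v ∈ reachSet G U u ∧ v ∈ reachSet G W u)
      ⟨self_mem_reachSet h0, self_mem_reachSet (h (self_mem_reachSet h0))⟩ ?_ hv
    intro x _ y hy hxy hx
    have hy' := reachSet_step hx.1 hxy hy
    exact ⟨hy', reachSet_step hx.2 hxy (h hy')⟩
  exact this.2

theorem reachSet_mono {U W : Set V} {u : V} (h : U ⊆ W) :
    reachSet G U u ⊆ reachSet G W u :=
  reachSet_subset_reachSet fun _ hv => h (mem_of_mem_reachSet hv)

theorem notMem_closedNbhd_iff {v z : V} :
    v ∉ closedNbhd G z ↔ v ≠ z ∧ ¬ G.Adj z v := by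
  simp [closedNbhd]

theorem length_pathMoves_support {W : Set V} {u w : W} (q : (G.induce W).Walk u w) :
    (pathMoves (q.support.map Subtype.val)).length = q.length := by
  simp [pathMoves]

end Reach

/-! ### Reconfiguration sequences -/

section Seq

variable {V : Type*} [DecidableEq V] {G : SimpleGraph V}

theorem IsReconfSeq.append {A B C : Finset V} {S T : List (V × V)}
    (h : IsReconfSeq G A S B) (h' : IsReconfSeq G B T C) : IsReconfSeq G A (S ++ T) C := by
  induction S generalizing A with
  | nil => cases h; exact h'
  | cons m S ih =>
    obtain ⟨u, v⟩ := m
    obtain ⟨h1, h2, h3, h4, h5⟩ := h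
    exact ⟨h1, h2, h3, h4, ih h5⟩

theorem IsReconfSeq.exists_walk {k : ℕ} (A B : IndepSets G k) {S : List (V × V)}
    (h : IsReconfSeq G A.1 S B.1) :
    ∃ w : (reconfGraph G k).Walk A B, w.length = S.length := by
  induction S generalizing A with
  | nil =>
    obtain rfl : A = B := Subtype.ext h
    exact ⟨.nil, rfl⟩
  | cons m S ih =>
    obtain ⟨u, v⟩ := m
    obtain ⟨h1, h2, h3, h4, h5⟩ := h
    have hcard : (insert v (A.1.erase u)).card = k := by
      rw [Finset.card_insert_of_notMem (fun h => h2 (Finset.mem_of_mem_erase h)),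
        Finset.card_erase_add_one h1, A.2.card_eq]
    obtain ⟨w, hw⟩ := ih ⟨insert v (A.1.erase u), ⟨h4, hcard⟩⟩ h5
    have hadj : (reconfGraph G k).Adj A ⟨insert v (A.1.erase u), ⟨h4, hcard⟩⟩ := by
      refine ⟨u, v, ?_, ?_, h3⟩
      · ext x
        simp only [Finset.mem_sdiff, Finset.mem_insert, Finset.mem_erase, Finset.mem_singleton]
        have := h3.ne
        grind
      · ext x
        simp only [Finset.mem_sdiff, Finset.mem_insert, Finset.mem_erase, Finset.mem_singleton]
        grind
    exact ⟨.cons hadj w, by simp [hw]⟩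

theorem exists_isReconfSeq_of_walk {k : ℕ} {A B : IndepSets G k}
    (w : (reconfGraph G k).Walk A B) :
    ∃ S : List (V × V), IsReconfSeq G A.1 S B.1 ∧ S.length = w.length := by
  induction w with
  | nil => exact ⟨[], rfl, rfl⟩
  | @cons A C B h w ih =>
    obtain ⟨S, hS, hl⟩ := ih
    obtain ⟨u, v, hu, hv, ha⟩ := h
    have hC : insert v (A.1.erase u) = C.1 := by
      ext x
      have h1 := Finset.ext_iff.1 hu x
      have h2 := Finset.ext_iff.1 hv x
      have h3 := Finset.ext_iff.1 hu u
      have h4 := Finset.ext_iff.1 hv v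
      simp only [Finset.mem_sdiff, Finset.mem_insert, Finset.mem_erase,
        Finset.mem_singleton] at *
      grind
    have h3 := Finset.ext_iff.1 hu u
    have h4 := Finset.ext_iff.1 hv v
    simp only [Finset.mem_sdiff, Finset.mem_singleton, iff_true] at h3 h4
    refine ⟨(u, v) :: S, ⟨h3.1, h4.2, ha, ?_, ?_⟩, congrArg (· + 1) hl⟩
    · rw [hC]; exact C.2.isIndepSet
    · rw [hC]; exact hS

/-- A token may follow any walk that stays out of the closed neighbourhoods of the others. -/
theorem isReconfSeq_of_walk {T : Finset V} (hT : G.IsIndepSet (T : Set V)) {W : Set V}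
    (hW : ∀ z ∈ T, ∀ v ∈ W, v ∉ closedNbhd G z) {u w : W} (q : (G.induce W).Walk u w) :
    IsReconfSeq G (insert u.1 T) (pathMoves (q.support.map Subtype.val)) (insert w.1 T) := by
  have hnot : ∀ x : W, x.1 ∉ T := fun x hx => by
    have := (notMem_closedNbhd_iff.1 (hW _ hx _ x.2)).1
    exact this rfl
  induction q with
  | nil => simp [pathMoves, IsReconfSeq]
  | @cons x y z h q ih =>
    have hadj : G.Adj x.1 y.1 := h
    have herase : (insert x.1 T).erase x.1 = T := Finset.erase_insert (hnot x)
    have hsupp : pathMoves ((SimpleGraph.Walk.cons h q).support.map Subtype.val) =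
        (x.1, y.1) :: pathMoves (q.support.map Subtype.val) := by
      cases q <;> simp [pathMoves]
    rw [hsupp]
    refine ⟨Finset.mem_insert_self _ _, ?_, hadj, ?_, ?_⟩
    · simp only [Finset.mem_insert, not_or]
      exact ⟨hadj.ne', hnot y⟩
    · rw [herase, Finset.coe_insert]
      intro a ha b hb hab
      rcases ha with rfl | ha <;> rcases hb with rfl | hb
      · exact absurd rfl hab
      · exact fun h' => (notMem_closedNbhd_iff.1 (hW _ hb _ y.2)).2 h'.symm
      · exact fun h' => (notMem_closedNbhd_iff.1 (hW _ ha _ y.2)).2 h'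
      · exact hT ha hb hab
    · rw [herase]; exact ih

end Seq

/-! ### Distinct endpoints -/

theorem IntervalRep.adj_iff_le {V : Type*} {G : SimpleGraph V} (R : IntervalRep G) (u v : V) :
    G.Adj u v ↔ u ≠ v ∧ R.left u ≤ R.right v ∧ R.left v ≤ R.right u := by
  rw [R.adj_iff]
  refine and_congr_right fun _ => ?_
  have hu := R.left_le_right u
  have hv := R.left_le_right v
  constructor
  · rintro ⟨x, ⟨h1, h2⟩, h3, h4⟩
    exact ⟨h1.trans h4, h3.trans h2⟩
  · rintro ⟨h1, h2⟩
    exact ⟨max (R.left u) (R.left v), ⟨le_max_left _ _, max_le hu h2⟩,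
      le_max_right _ _, max_le h1 hv⟩

/-- Equal endpoints are separated by putting left ends before right ends, so that touching closed
intervals still meet, and then by an enumeration of the vertices. Counting the smaller keys turns
this lexicographic order back into real numbers. -/
theorem IntervalRep.nonempty_distinctRep {V : Type*} [Fintype V] {G : SimpleGraph V}
    (R : IntervalRep G) : Nonempty (DistinctRep G) := by
  classical
  let e := Fintype.equivFin V
  let key : V ⊕ V → ℝ ×ₗ (ℕ ×ₗ ℕ) := Sum.elim
    (fun v => toLex (R.left v, toLex (0, (e v).1))) (fun v => toLex (R.right v, toLex (1, (e v).1)))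
  have hkey : Function.Injective key := by
    rintro (u | u) (v | v) h
    · have h2 := congrArg (fun x => (ofLex (ofLex x).2).2) h
      exact congrArg _ (e.injective (Fin.ext h2))
    · have h2 := congrArg (fun x => (ofLex (ofLex x).2).1) h
      simp [key] at h2
    · have h2 := congrArg (fun x => (ofLex (ofLex x).2).1) h
      simp [key] at h2
    · have h2 := congrArg (fun x => (ofLex (ofLex x).2).2) h
      exact congrArg _ (e.injective (Fin.ext h2))
  let rank : V ⊕ V → ℝ := fun x => (Finset.univ.filter fun y => key y < key x).card
  have hlt : ∀ x y, key x < key y → rank x < rank y := by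
    intro x y h
    simp only [rank, Nat.cast_lt]
    apply Finset.card_lt_card
    rw [Finset.ssubset_iff_of_subset]
    · exact ⟨x, by simpa using h, by simp⟩
    · intro z hz
      simp only [Finset.mem_filter, Finset.mem_univ, true_and] at hz ⊢
      exact hz.trans h
  have hle : ∀ x y, rank x ≤ rank y ↔ key x ≤ key y := by
    intro x y
    constructor
    · intro h
      by_contra h'
      exact absurd h (not_le.2 (hlt _ _ (not_le.1 h')))
    · intro h
      rcases h.lt_or_eq with h | h
      · exact (hlt _ _ h).le
      · rw [hkey h]
  have hinj : Function.Injective rank := by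
    intro x y h
    exact hkey (le_antisymm ((hle _ _).1 h.le) ((hle _ _).1 h.ge))
  have hlr : ∀ u v, rank (.inl u) ≤ rank (.inr v) ↔ R.left u ≤ R.right v := by
    intro u v
    rw [hle]
    simp only [key, Sum.elim_inl, Sum.elim_inr, Prod.Lex.toLex_le_toLex]
    constructor
    · rintro (h | h)
      · exact h.le
      · exact h.1.le
    · intro h
      rcases h.lt_or_eq with h | h
      · exact Or.inl h
      · exact Or.inr ⟨h, Or.inl one_pos⟩
  have hlr' : ∀ v, rank (.inl v) ≤ rank (.inr v) := fun v => (hlr v v).2 (R.left_le_right v)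
  refine ⟨⟨⟨fun v => rank (.inl v), fun v => rank (.inr v), hlr', ?_⟩, ?_⟩⟩
  · intro u v
    rw [R.adj_iff_le]
    refine and_congr_right fun _ => ?_
    rw [← hlr, ← hlr]
    constructor
    · rintro ⟨h1, h2⟩
      exact ⟨max (rank (.inl u)) (rank (.inl v)), ⟨le_max_left _ _, max_le (hlr' u) h2⟩,
        le_max_right _ _, max_le h1 (hlr' v)⟩
    · rintro ⟨x, ⟨h1, h2⟩, h3, h4⟩
      exact ⟨h1.trans h4, h3.trans h2⟩
  · have : Sum.elim (fun v => rank (.inl v)) (fun v => rank (.inr v)) = rank := by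
      ext (x | x) <;> rfl
    simpa only [this] using hinj

/-! ### Positions on the line -/

namespace DistinctRep

section Line

variable {V : Type*} {G : SimpleGraph V}

/-- The interval of `u` lies entirely to the left of the interval of `v`. -/
def Before (R : DistinctRep G) (u v : V) : Prop := R.right u < R.left v

variable {R : DistinctRep G}

theorem left_injective (R : DistinctRep G) : Function.Injective R.left := fun _ _ h =>
  Sum.inl_injective (R.endpoints_injective h)

theorem right_injective (R : DistinctRep G) : Function.Injective R.right := fun _ _ h =>
  Sum.inr_injective (R.endpoints_injective h)

theorem Before.trans {u v w : V} (h : R.Before u v) (h' : R.Before v w) : R.Before u w :=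
  lt_trans h (lt_of_le_of_lt (R.left_le_right v) h')

theorem Before.ne {u v : V} (h : R.Before u v) : u ≠ v := by
  rintro rfl
  exact absurd h (not_lt.2 (R.left_le_right u))

theorem adj_iff_before {u v : V} : G.Adj u v ↔ u ≠ v ∧ ¬ R.Before u v ∧ ¬ R.Before v u := by
  rw [R.adj_iff_le, Before, Before, not_lt, not_lt]
  tauto

theorem notMem_closedNbhd_iff_before {v z : V} :
    v ∉ closedNbhd G z ↔ R.Before v z ∨ R.Before z v := by
  rw [notMem_closedNbhd_iff, adj_iff_before (R := R)]
  constructor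
  · rintro ⟨h1, h2⟩
    by_contra h3
    push Not at h3
    exact h2 ⟨h1.symm, h3.2, h3.1⟩
  · rintro (h | h)
    · exact ⟨h.ne, fun h' => h'.2.2 h⟩
    · exact ⟨h.ne.symm, fun h' => h'.2.1 h⟩

/-- Passing from one side of `z` to the other along an edge is impossible: two vertices separated by
the interval of `z` are not adjacent. -/
theorem before_of_reach_left {W : Set V} {u v z : V} (hW : ∀ x ∈ W, x ∉ closedNbhd G z)
    (hu : R.Before u z) (hv : v ∈ reachSet G W u) : R.Before v z := by
  refine reachSet_induction (p := fun v => R.Before v z) hu ?_ hv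
  intro x _ y hy hxy hx
  rcases (notMem_closedNbhd_iff_before (R := R)).1 (hW y hy) with h | h
  · exact h
  · exact absurd (hx.trans h) (adj_iff_before.1 hxy).2.1

theorem before_of_reach_right {W : Set V} {u v z : V} (hW : ∀ x ∈ W, x ∉ closedNbhd G z)
    (hu : R.Before z u) (hv : v ∈ reachSet G W u) : R.Before z v := by
  refine reachSet_induction (p := fun v => R.Before z v) hu ?_ hv
  intro x _ y hy hxy hx
  rcases (notMem_closedNbhd_iff_before (R := R)).1 (hW y hy) with h | h
  · exact absurd (h.trans hx) (adj_iff_before.1 hxy).2.2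
  · exact h

/-- The intervals `c 0, c 1, …` are pairwise disjoint and listed from left to right. -/
def Sorted (R : DistinctRep G) {k : ℕ} (c : Fin k → V) : Prop :=
  ∀ i j, i < j → R.Before (c i) (c j)

theorem sorted_of_consecutive {k : ℕ} {c : Fin k → V}
    (h : ∀ i j : Fin k, i.1 + 1 = j.1 → R.Before (c i) (c j)) : R.Sorted c := by
  intro i ⟨j, hj⟩ hij
  induction j with
  | zero => exact absurd hij (by simp [Fin.lt_def])
  | succ j ih =>
    have hb : R.Before (c ⟨j, by omega⟩) (c ⟨j + 1, hj⟩) := h _ _ rfl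
    rcases Nat.lt_or_ge i.1 j with hlt | hge
    · exact (ih (by omega) hlt).trans hb
    · have : i = ⟨j, by omega⟩ := Fin.ext (by rw [Fin.lt_def] at hij; simp only at hij ⊢; omega)
      rw [this]
      exact hb

theorem Sorted.injective {k : ℕ} {c : Fin k → V} (h : R.Sorted c) : Function.Injective c := by
  intro i j hij
  rcases lt_trichotomy i j with hlt | rfl | hlt
  · exact absurd hij (h _ _ hlt).ne
  · rfl
  · exact absurd hij.symm (h _ _ hlt).ne

theorem Sorted.notMem_closedNbhd {k : ℕ} {c : Fin k → V} (h : R.Sorted c) {i j : Fin k}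
    (hij : i ≠ j) : c i ∉ closedNbhd G (c j) := by
  rw [notMem_closedNbhd_iff_before (R := R)]
  exact hij.lt_or_gt.imp (h _ _) (h _ _)

theorem Sorted.not_adj {k : ℕ} {c : Fin k → V} (h : R.Sorted c) (i j : Fin k) :
    ¬ G.Adj (c i) (c j) := by
  by_cases hij : i = j
  · rw [hij]; exact G.loopless.irrefl _
  · exact fun h' => (notMem_closedNbhd_iff.1 (h.notMem_closedNbhd hij)).2 h'.symm

theorem sorted_proj (R : DistinctRep G) {k : ℕ} (A : IndepSets G k) : R.Sorted (R.proj A) := by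
  intro i j hij
  have hmem : ∀ i, R.proj A i ∈ A.1 := fun i =>
    @Finset.orderEmbOfFin_mem V R.leftOrder A.1 k A.2.card_eq i
  have hlt : R.left (R.proj A i) < R.left (R.proj A j) :=
    (@OrderEmbedding.strictMono _ _ _ R.leftOrder.toPreorder
      (@Finset.orderEmbOfFin V R.leftOrder A.1 k A.2.card_eq)) hij
  have hne : R.proj A i ≠ R.proj A j := fun h => by rw [h] at hlt; exact lt_irrefl _ hlt
  have hna := A.2.isIndepSet (hmem i) (hmem j) hne
  by_contra hb
  refine hna (adj_iff_before.2 ⟨hne, hb, fun h' => ?_⟩)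
  exact absurd (lt_of_le_of_lt (R.left_le_right _) h') (not_lt.2 hlt.le)

end Line

/-! ### Sorted configurations and independent sets -/

section Tokens

variable {V : Type*} [DecidableEq V] {G : SimpleGraph V} {R : DistinctRep G} {k : ℕ}

/-- The set of vertices occupied by the tokens of a configuration. -/
def tokens (c : Fin k → V) : Finset V := Finset.univ.image c

@[simp] theorem mem_tokens {c : Fin k → V} {v : V} : v ∈ tokens c ↔ ∃ i, c i = v := by
  simp [tokens]

theorem isNIndepSet_tokens {c : Fin k → V} (h : R.Sorted c) :
    G.IsNIndepSet k (tokens c) := by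
  refine ⟨?_, ?_⟩
  · intro u hu v hv _
    obtain ⟨i, rfl⟩ := mem_tokens.1 hu
    obtain ⟨j, rfl⟩ := mem_tokens.1 hv
    exact h.not_adj i j
  · rw [tokens, Finset.card_image_of_injective _ h.injective, Finset.card_univ, Fintype.card_fin]

theorem proj_eq_of_sorted {c : Fin k → V} (h : R.Sorted c) {A : IndepSets G k}
    (hA : A.1 = tokens c) : R.proj A = c := by
  symm
  refine @Finset.orderEmbOfFin_unique V R.leftOrder A.1 k A.2.card_eq c ?_ ?_
  · intro i
    rw [hA]
    exact mem_tokens.2 ⟨i, rfl⟩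
  · intro i j hij
    have hlt : R.left (c i) < R.left (c j) := lt_of_le_of_lt (R.left_le_right _) (h _ _ hij)
    exact hlt

theorem tokens_proj (R : DistinctRep G) (A : IndepSets G k) : tokens (R.proj A) = A.1 := by
  apply Finset.eq_of_subset_of_card_le
  · intro v hv
    obtain ⟨i, rfl⟩ := mem_tokens.1 hv
    exact @Finset.orderEmbOfFin_mem V R.leftOrder A.1 k A.2.card_eq i
  · rw [(isNIndepSet_tokens (R.sorted_proj A)).card_eq, A.2.card_eq]

/-- Sliding a token does not change the order of the tokens. -/
theorem exists_proj_eq_update {A B : IndepSets G k} (h : (reconfGraph G k).Adj A B) :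
    ∃ i v, G.Adj (R.proj A i) v ∧ R.proj B = Function.update (R.proj A) i v := by
  obtain ⟨u, v, hu, hv, ha⟩ := h
  have hu' : u ∈ A.1 ∧ u ∉ B.1 := by
    rw [← Finset.mem_sdiff, hu]; exact Finset.mem_singleton_self u
  have hv' : v ∈ B.1 ∧ v ∉ A.1 := by
    rw [← Finset.mem_sdiff, hv]; exact Finset.mem_singleton_self v
  obtain ⟨i, hi⟩ := mem_tokens.1 ((R.tokens_proj A).symm ▸ hu'.1)
  subst hi
  have hs := R.sorted_proj A
  have hmem : ∀ j, R.proj A j ∈ A.1 := fun j => by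
    rw [← R.tokens_proj A]; exact mem_tokens.2 ⟨j, rfl⟩
  have hB : ∀ j, j ≠ i → R.proj A j ∈ B.1 := by
    intro j hj
    by_contra hn
    have : R.proj A j ∈ A.1 \ B.1 := Finset.mem_sdiff.2 ⟨hmem j, hn⟩
    rw [hu, Finset.mem_singleton] at this
    exact hj (hs.injective this)
  have hna : ∀ j, j ≠ i → R.Before (R.proj A j) v ∨ R.Before v (R.proj A j) := by
    intro j hj
    have hne : R.proj A j ≠ v := fun h => hv'.2 (h ▸ hmem j)
    have : ¬ G.Adj (R.proj A j) v := B.2.isIndepSet (hB j hj) hv'.1 hne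
    rw [adj_iff_before (R := R)] at this
    tauto
  have hadj := (adj_iff_before (R := R)).1 ha
  have hsort : R.Sorted (Function.update (R.proj A) i v) := by
    intro j l hjl
    by_cases hj : j = i
    · subst hj
      rw [Function.update_self, Function.update_of_ne hjl.ne']
      -- If `v` lay beyond another token, that token would separate it from the vertex being left,
      -- against their adjacency.
      exact (hna l hjl.ne').resolve_left fun h => hadj.2.1 ((hs _ _ hjl).trans h)
    · rw [Function.update_of_ne hj]
      by_cases hl : l = i
      · subst hl
        rw [Function.update_self]
        exact (hna j hj).resolve_right fun h => hadj.2.2 (h.trans (hs _ _ hjl))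
      · rw [Function.update_of_ne hl]
        exact hs _ _ hjl
  refine ⟨i, v, ha, proj_eq_of_sorted hsort ?_⟩
  symm
  apply Finset.eq_of_subset_of_card_le
  · intro x hx
    obtain ⟨j, rfl⟩ := mem_tokens.1 hx
    by_cases hj : j = i
    · subst hj; rw [Function.update_self]; exact hv'.1
    · rw [Function.update_of_ne hj]; exact hB j hj
  · rw [(isNIndepSet_tokens hsort).card_eq, B.2.card_eq]

theorem tokens_update (c : Fin k → V) (i : Fin k) (w : V) :
    tokens (Function.update c i w) = insert w ((Finset.univ.erase i).image c) := by
  ext x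
  simp only [mem_tokens, Finset.mem_insert, Finset.mem_image, Finset.mem_erase, Finset.mem_univ,
    and_true]
  constructor
  · rintro ⟨j, rfl⟩
    by_cases hj : j = i
    · subst hj; simp
    · exact Or.inr ⟨j, hj, (Function.update_of_ne hj _ _).symm⟩
  · rintro (rfl | ⟨j, hj, rfl⟩)
    · exact ⟨i, Function.update_self ..⟩
    · exact ⟨j, Function.update_of_ne hj _ _⟩

end Tokens

/-! ### Pushing a token -/

section Push

variable {V : Type*} {G : SimpleGraph V} {R : DistinctRep G} {k : ℕ}

/-- What a list of moves that takes one token from `u` to `w` inside `W` has to satisfy. -/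
structure IsTokenPath [Fintype V] [DecidableEq V] (G : SimpleGraph V) (W : Set V) (u w : V)
    (m : List (V × V)) : Prop where
  mem : w ∈ reachSet G W u
  length_le : m.length ≤ Fintype.card V
  eq_of_nil : m = [] → w = u
  nil_of_eq : w = u → m = []
  isReconfSeq : ∀ T : Finset V, G.IsIndepSet (T : Set V) →
    (∀ z ∈ T, ∀ v ∈ W, v ∉ closedNbhd G z) → IsReconfSeq G (insert u T) m (insert w T)

variable [Fintype V] [DecidableEq V]

/-- A shortest path repeats no vertex, hence the bound n. It is empty when its ends agree, so a
nonempty list of moves always signals a changed position. -/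
theorem isTokenPath_pathMoves (P : ShortestPathRule G) {W : Set V} {u w : V}
    (h : w ∈ reachSet G W u) : IsTokenPath G W u w (pathMoves (P.path W u w)) := by
  obtain ⟨hu, hw, q, hq, hp⟩ := P.isShortest W u w h
  have hlen : (pathMoves (P.path W u w)).length = q.length := by
    rw [← hp, length_pathMoves_support]
  refine ⟨h, ?_, ?_, ?_, ?_⟩
  · classical
    rw [hlen]
    have := (q.isPath_of_length_eq_dist hq).length_lt
    exact this.le.trans (Fintype.card_subtype_le _)
  · intro h0
    rw [h0, List.length_nil] at hlen
    exact (congrArg Subtype.val (SimpleGraph.Walk.eq_of_length_eq_zero hlen.symm)).symm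
  · rintro rfl
    rw [SimpleGraph.dist_self] at hq
    exact List.length_eq_zero_iff.1 (hlen.trans hq)
  · intro T hT hW
    rw [← hp]
    exact isReconfSeq_of_walk hT hW q

theorem pushTokenLeft_spec (R : DistinctRep G) (P : ShortestPathRule G) {W : Set V} {u : V}
    (hu : u ∈ W) : ∃ w m, R.pushTokenLeft P W u = Part.some (w, m) ∧ IsTokenPath G W u w m ∧
      ∀ v ∈ reachSet G W u, R.right w ≤ R.right v := by
  have hs : (reachSet G W u).Nonempty := ⟨u, self_mem_reachSet hu⟩
  have h := (Set.exists_min_image (reachSet G W u) R.right (Set.toFinite _) hs).choose_spec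
  exact ⟨R.minRight _ hs, _, Part.assert_pos hs, isTokenPath_pathMoves P h.1, h.2⟩

theorem pushTokenRight_spec (R : DistinctRep G) (P : ShortestPathRule G) {W : Set V} {u : V}
    (hu : u ∈ W) : ∃ w m, R.pushTokenRight P W u = Part.some (w, m) ∧ IsTokenPath G W u w m ∧
      ∀ v ∈ reachSet G W u, R.left v ≤ R.left w := by
  have hs : (reachSet G W u).Nonempty := ⟨u, self_mem_reachSet hu⟩
  have h := (Set.exists_max_image (reachSet G W u) R.left (Set.toFinite _) hs).choose_spec
  exact ⟨R.maxLeft _ hs, _, Part.assert_pos hs, isTokenPath_pathMoves P h.1, h.2⟩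

theorem IsTokenPath.isReconfSeq_tokens {W : Set V} {c : Fin k → V} {i : Fin k} {w : V}
    {m : List (V × V)} (h : IsTokenPath G W (c i) w m) (hc : R.Sorted c)
    (hW : ∀ j, j ≠ i → ∀ v ∈ W, v ∉ closedNbhd G (c j)) :
    IsReconfSeq G (tokens c) m (tokens (Function.update c i w)) := by
  have h0 := tokens_update c i (c i)
  rw [Function.update_eq_self] at h0
  rw [tokens_update, h0]
  refine h.isReconfSeq _ ?_ ?_
  · intro u hu v hv _
    simp only [Finset.coe_image, Set.mem_image] at hu hv
    obtain ⟨a, _, rfl⟩ := hu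
    obtain ⟨b, _, rfl⟩ := hv
    exact hc.not_adj a b
  · intro z hz v hv
    simp only [Finset.mem_image, Finset.mem_erase, Finset.mem_univ, and_true] at hz
    obtain ⟨j, hj, rfl⟩ := hz
    exact hW j hj v hv

end Push

/-! ### Recorded extremes -/

section Linked

variable {V : Type*} {G : SimpleGraph V} {R : DistinctRep G} {k : ℕ} {l r : Fin k → V}

/-- The vertices strictly between the recorded left extreme of the previous position and the
recorded right extreme of the next position. -/
def region (R : DistinctRep G) (l r : Fin k → V) (i : Fin k) : Set V :=
  {v | (∀ h : Fin k, h.1 + 1 = i.1 → R.Before (l h) v) ∧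
    ∀ h : Fin k, i.1 + 1 = h.1 → R.Before v (r h)}

/-- At each position the recorded extremes are connected inside the region of this position. -/
def Linked (R : DistinctRep G) (l r : Fin k → V) : Prop :=
  ∀ i, r i ∈ reachSet G (R.region l r i) (l i)

/-- The configuration with left extremes at the first `m` positions and right extremes at the
others. -/
def mixed (l r : Fin k → V) (m : ℕ) (i : Fin k) : V := if i.1 < m then l i else r i

theorem mixed_of_lt {m : ℕ} {i : Fin k} (h : i.1 < m) : mixed l r m i = l i := if_pos h

theorem mixed_of_le {m : ℕ} {i : Fin k} (h : m ≤ i.1) : mixed l r m i = r i :=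
  if_neg (not_lt.2 h)

/-- For these `m` the mixtures differ only at `p` and `q`, and both entries are overwritten. -/
theorem mixed_update_update {m : ℕ} {p q : Fin k} (hpq : p.1 + 1 = q.1)
    (hm : m = p.1 ∨ m = p.1 + 1 ∨ m = p.1 + 2) (x y : V) :
    Function.update (Function.update (mixed l r m) p x) q y =
      mixed (Function.update l p x) (Function.update r q y) (p.1 + 1) := by
  ext i
  by_cases hq : i = q
  · subst hq
    rw [Function.update_self, mixed_of_le (by omega), Function.update_self]
  · rw [Function.update_of_ne hq]
    by_cases hp : i = p
    · subst hp
      rw [Function.update_self, mixed_of_lt (by omega), Function.update_self]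
    · rw [Function.update_of_ne hp]
      have hp' : i.1 ≠ p.1 := fun h => hp (Fin.ext h)
      have hq' : i.1 ≠ q.1 := fun h => hq (Fin.ext h)
      rcases Nat.lt_or_ge i.1 m with h | h
      · rw [mixed_of_lt h, mixed_of_lt (by omega), Function.update_of_ne hp]
      · rw [mixed_of_le h, mixed_of_le (by omega), Function.update_of_ne hq]

theorem Linked.left_mem (h : R.Linked l r) (i : Fin k) : l i ∈ R.region l r i :=
  source_mem_of_mem_reachSet (h i)

theorem Linked.right_mem (h : R.Linked l r) (i : Fin k) : r i ∈ R.region l r i :=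
  mem_of_mem_reachSet (h i)

/-- Consecutive pairs have the form left-left, left-right or right-right, and each is separated by a
region condition. A right record followed by a left one never occurs; `Linked` does not control that
pair. -/
theorem Linked.sorted_mixed (h : R.Linked l r) (m : ℕ) : R.Sorted (mixed l r m) := by
  apply sorted_of_consecutive
  intro i j hij
  rcases Nat.lt_or_ge i.1 m with hi | hi
  · rw [mixed_of_lt hi]
    rcases Nat.lt_or_ge j.1 m with hj | hj
    · rw [mixed_of_lt hj]; exact (h.left_mem j).1 i hij
    · rw [mixed_of_le hj]; exact (h.left_mem i).2 j hij
  · rw [mixed_of_le hi, mixed_of_le (by omega)]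
    exact (h.right_mem i).2 j hij

theorem Linked.sorted_left (h : R.Linked l r) : R.Sorted l := by
  have := h.sorted_mixed k
  rwa [show mixed l r k = l from funext fun i => mixed_of_lt i.2] at this

theorem Linked.sorted_right (h : R.Linked l r) : R.Sorted r := by
  have := h.sorted_mixed 0
  rwa [show mixed l r 0 = r from funext fun i => mixed_of_le (Nat.zero_le _)] at this

theorem Linked.left_before (h : R.Linked l r) {i j : Fin k} (hji : j < i) {v : V}
    (hv : v ∈ R.region l r i) : R.Before (l j) v := by
  rw [Fin.lt_def] at hji
  let i' : Fin k := ⟨i.1 - 1, by omega⟩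
  have hi' : R.Before (l i') v := hv.1 i' (by simp only [i']; omega)
  rcases Nat.lt_or_ge j.1 i'.1 with hlt | hge
  · exact (h.sorted_left j i' hlt).trans hi'
  · have : j = i' := Fin.ext (by simp only [i'] at hge ⊢; omega)
    rwa [this]

theorem Linked.before_right (h : R.Linked l r) {i j : Fin k} (hij : i < j) {v : V}
    (hv : v ∈ R.region l r i) : R.Before v (r j) := by
  rw [Fin.lt_def] at hij
  let i' : Fin k := ⟨i.1 + 1, by omega⟩
  have hi' : R.Before v (r i') := hv.2 i' rfl
  rcases Nat.lt_or_ge i'.1 j.1 with hlt | hge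
  · exact hi'.trans (h.sorted_right i' j hlt)
  · have : j = i' := Fin.ext (by simp only [i'] at hge ⊢; omega)
    rwa [this]

/-- A region avoids the closed neighbourhoods of all the tokens at other positions. -/
theorem Linked.notMem_closedNbhd_mixed (h : R.Linked l r) {i j : Fin k} (hij : j ≠ i) {m : ℕ}
    (hm : m = i.1 ∨ m = i.1 + 1) {v : V} (hv : v ∈ R.region l r i) :
    v ∉ closedNbhd G (mixed l r m j) := by
  rw [notMem_closedNbhd_iff_before (R := R)]
  rcases hij.lt_or_gt with hlt | hlt
  · rw [mixed_of_lt (by rw [Fin.lt_def] at hlt; omega)]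
    exact Or.inr (h.left_before hlt hv)
  · rw [mixed_of_le (by rw [Fin.lt_def] at hlt; omega)]
    exact Or.inl (h.before_right hlt hv)

theorem region_congr {l' r' : Fin k → V} {i : Fin k} (hl : ∀ h : Fin k, h.1 + 1 = i.1 → l' h = l h)
    (hr : ∀ h : Fin k, i.1 + 1 = h.1 → r' h = r h) : R.region l' r' i = R.region l r i := by
  ext v
  refine and_congr ?_ ?_
  · exact forall₂_congr fun h hh => by rw [hl h hh]
  · exact forall₂_congr fun h hh => by rw [hr h hh]

theorem region_subset {l' r' : Fin k → V} (hl : ∀ h, R.right (l' h) ≤ R.right (l h))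
    (hr : ∀ h, R.left (r h) ≤ R.left (r' h)) (i : Fin k) : R.region l r i ⊆ R.region l' r' i :=
  fun _ hv => ⟨fun h hh => lt_of_le_of_lt (hl h) (hv.1 h hh),
    fun h hh => lt_of_lt_of_le (hv.2 h hh) (hr h)⟩

theorem right_update_le {i : Fin k} {w : V} (hw : R.right w ≤ R.right (l i)) (h : Fin k) :
    R.right (Function.update l i w h) ≤ R.right (l h) := by
  by_cases hi : h = i
  · subst hi; rwa [Function.update_self]
  · rw [Function.update_of_ne hi]

theorem left_le_update {i : Fin k} {w : V} (hw : R.left (r i) ≤ R.left w) (h : Fin k) :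
    R.left (r h) ≤ R.left (Function.update r i w h) := by
  by_cases hi : h = i
  · subst hi; rwa [Function.update_self]
  · rw [Function.update_of_ne hi]

/-- The region of `i` does not involve the records at `i`, so `w` can replace `l i` as starting
point there. A smaller right end only enlarges the other regions. -/
theorem Linked.update_left (h : R.Linked l r) {i : Fin k} {w : V}
    (hw : w ∈ reachSet G (R.region l r i) (l i)) (hle : R.right w ≤ R.right (l i)) :
    R.Linked (Function.update l i w) r := by
  intro j
  have hsub := region_subset (R := R) (right_update_le hle) (fun h => le_refl (R.left (r h))) j
  by_cases hj : j = i
  · subst hj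
    rw [Function.update_self]
    exact reachSet_mono hsub (reachSet_trans (reachSet_symm hw) (h j))
  · rw [Function.update_of_ne hj]
    exact reachSet_mono hsub (h j)

theorem Linked.update_right (h : R.Linked l r) {i : Fin k} {w : V}
    (hw : w ∈ reachSet G (R.region l r i) (l i)) (hle : R.left (r i) ≤ R.left w) :
    R.Linked l (Function.update r i w) := by
  intro j
  have hsub := region_subset (R := R) (fun h => le_refl (R.right (l h))) (left_le_update hle) j
  by_cases hj : j = i
  · subst hj
    rw [Function.update_self]
    exact reachSet_mono hsub hw
  · rw [Function.update_of_ne hj]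
    exact reachSet_mono hsub (h j)

theorem Linked.mixed_mem (h : R.Linked l r) (m : ℕ) (i : Fin k) :
    mixed l r m i ∈ reachSet G (R.region l r i) (l i) := by
  rcases Nat.lt_or_ge i.1 m with hi | hi
  · rw [mixed_of_lt hi]; exact self_mem_reachSet (h.left_mem i)
  · rw [mixed_of_le hi]; exact h i

/-- The recorded left extreme at `i` cannot be improved inside the region of `i`. -/
def LeftStable (R : DistinctRep G) (l r : Fin k → V) (i : Fin k) : Prop :=
  ∀ v ∈ reachSet G (R.region l r i) (l i), R.right (l i) ≤ R.right v

/-- The recorded right extreme at `i` cannot be improved inside the region of `i`. -/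
def RightStable (R : DistinctRep G) (l r : Fin k → V) (i : Fin k) : Prop :=
  ∀ v ∈ reachSet G (R.region l r i) (l i), R.left v ≤ R.left (r i)

/-- If no extreme can be improved, then no reconfiguration leads out of the regions. -/
theorem proj_mem_of_reachable [DecidableEq V]
    (hl : ∀ i : Fin k, i.1 + 1 < k → R.LeftStable l r i)
    (hr : ∀ i : Fin k, 0 < i.1 → R.RightStable l r i) {A B : IndepSets G k}
    (hA : ∀ i, R.proj A i ∈ reachSet G (R.region l r i) (l i))
    (hAB : (reconfGraph G k).Reachable A B) (i : Fin k) :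
    R.proj B i ∈ reachSet G (R.region l r i) (l i) := by
  obtain ⟨w⟩ := hAB
  induction w with
  | nil => exact hA i
  | @cons A C B h w ih =>
    refine ih ?_
    obtain ⟨j, v, hv, hC⟩ := exists_proj_eq_update (R := R) h
    have hs := R.sorted_proj C
    rw [hC] at hs
    rw [hC]
    intro i
    by_cases hi : i = j
    · subst hi
      rw [Function.update_self]
      -- The neighbouring tokens keep `v` inside the region: by stability, the record at `h` is at
      -- least as extreme as the token at `h`, which is already disjoint from `v` on the correct
      -- side.
      refine reachSet_step (hA i) hv ⟨fun h hh => ?_, fun h hh => ?_⟩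
      · have h1 := hs h i (by rw [Fin.lt_def]; omega)
        rw [Function.update_self, Function.update_of_ne (by rintro rfl; omega)] at h1
        exact lt_of_le_of_lt (hl h (by omega) _ (hA h)) h1
      · have h1 := hs i h (by rw [Fin.lt_def]; omega)
        rw [Function.update_self, Function.update_of_ne (by rintro rfl; omega)] at h1
        exact lt_of_lt_of_le h1 (hr h (by omega) _ (hA h))
    · rw [Function.update_of_ne hi]
      exact hA i

end Linked

/-! ### The potential -/

section Potential

variable {V : Type*} [Fintype V] {G : SimpleGraph V} {R : DistinctRep G} {k : ℕ}
  {l r l' r' : Fin k → V}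

open Classical in
/-- The number of possible improvements of the recorded extremes. -/
def potential (R : DistinctRep G) (l r : Fin k → V) : ℕ :=
  ∑ i, ((Finset.univ.filter fun v => R.right v < R.right (l i)).card +
    (Finset.univ.filter fun v => R.left (r i) < R.left v).card)

theorem potential_le (R : DistinctRep G) (l r : Fin k → V) :
    R.potential l r ≤ k * (2 * Fintype.card V) := by
  classical
  refine (Finset.sum_le_card_nsmul _ _ (2 * Fintype.card V) ?_).trans (by simp)
  intro i _
  rw [two_mul]
  exact add_le_add (Finset.card_le_univ _) (Finset.card_le_univ _)

theorem potential_mono (hl : ∀ i, R.right (l' i) ≤ R.right (l i))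
    (hr : ∀ i, R.left (r i) ≤ R.left (r' i)) : R.potential l' r' ≤ R.potential l r := by
  classical
  refine Finset.sum_le_sum fun i _ => add_le_add ?_ ?_ <;> apply Finset.card_le_card
  · exact Finset.monotone_filter_right _ fun v _ hv => lt_of_lt_of_le hv (hl i)
  · exact Finset.monotone_filter_right _ fun v _ hv => lt_of_le_of_lt (hr i) hv

/-- Since endpoints are distinct, a changed record is strictly better, and the new record itself
drops out of the count. -/
theorem potential_lt (hl : ∀ i, R.right (l' i) ≤ R.right (l i))
    (hr : ∀ i, R.left (r i) ≤ R.left (r' i)) (hne : ∃ i, l' i ≠ l i ∨ r' i ≠ r i) :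
    R.potential l' r' < R.potential l r := by
  classical
  have hl' : ∀ i, (Finset.univ.filter fun v => R.right v < R.right (l' i)).card ≤
      (Finset.univ.filter fun v => R.right v < R.right (l i)).card := fun i =>
    Finset.card_le_card (Finset.monotone_filter_right _ fun v _ hv => lt_of_lt_of_le hv (hl i))
  have hr' : ∀ i, (Finset.univ.filter fun v => R.left (r' i) < R.left v).card ≤
      (Finset.univ.filter fun v => R.left (r i) < R.left v).card := fun i =>
    Finset.card_le_card (Finset.monotone_filter_right _ fun v _ hv => lt_of_le_of_lt (hr i) hv)
  refine Finset.sum_lt_sum (fun i _ => add_le_add (hl' i) (hr' i)) ?_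
  obtain ⟨i, hi | hi⟩ := hne
  · refine ⟨i, Finset.mem_univ _, add_lt_add_of_lt_of_le ?_ (hr' i)⟩
    have hlt := lt_of_le_of_ne (hl i) fun h => hi (R.right_injective h)
    apply Finset.card_lt_card
    rw [Finset.ssubset_iff_of_subset
      (Finset.monotone_filter_right _ fun v _ hv => lt_of_lt_of_le hv (hl i))]
    exact ⟨l' i, by simpa using hlt, by simp⟩
  · refine ⟨i, Finset.mem_univ _, add_lt_add_of_le_of_lt (hl' i) ?_⟩
    have hlt := lt_of_le_of_ne (hr i) fun h => hi (R.left_injective h.symm)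
    apply Finset.card_lt_card
    rw [Finset.ssubset_iff_of_subset
      (Finset.monotone_filter_right _ fun v _ hv => lt_of_le_of_lt (hr i) hv)]
    exact ⟨r' i, by simpa using hlt, by simp⟩

end Potential

/-! ### Pushing two tokens apart -/

section PushApart

variable {V : Type*} [Fintype V] [DecidableEq V] {G : SimpleGraph V} {R : DistinctRep G} {k : ℕ}
  {l r : Fin k → V}

/-- The moves `S` take the tokens at `p` and `q` of the configuration `c` to `x` and `y`, which
improve the recorded extremes `l p` and `r q`; apart from `b` moves, the length of `S` is paid
for by the decrease of the potential. -/
structure Improves (R : DistinctRep G) (l r : Fin k → V) (p q : Fin k) (c : Fin k → V) (x y : V)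
    (S : List (V × V)) (b : ℕ) : Prop where
  linked : R.Linked (Function.update l p x) (Function.update r q y)
  right_le : R.right x ≤ R.right (l p)
  left_le : R.left (r q) ≤ R.left y
  isReconfSeq : IsReconfSeq G (tokens c) S
    (tokens (Function.update (Function.update c p x) q y))
  length_le : S.length +
    Fintype.card V * R.potential (Function.update l p x) (Function.update r q y) ≤
      Fintype.card V * R.potential l r + b

/-- The second budget is 0 because later passes start with both tokens at their records. -/
theorem Improves.trans {p q : Fin k} {c : Fin k → V} {x y x' y' : V}
    {S S' : List (V × V)} {b : ℕ} (h : R.Improves l r p q c x y S b)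
    (h' : R.Improves (Function.update l p x) (Function.update r q y) p q
      (Function.update (Function.update c p x) q y) x' y' S' 0) :
    R.Improves l r p q c x' y' (S ++ S') b := by
  obtain ⟨h1, h2, h3, h4, h5⟩ := h
  obtain ⟨h1', h2', h3', h4', h5'⟩ := h'
  simp only [Function.update_idem, Function.update_self] at h1' h2' h3' h5'
  have hc : Function.update (Function.update (Function.update (Function.update c p x) q y) p x')
      q y' = Function.update (Function.update c p x') q y' := by
    ext i
    simp only [Function.update_apply]
    split_ifs <;> rfl
  rw [hc] at h4'
  exact ⟨h1', h2'.trans h2, h3.trans h3', h4.append h4', by rw [List.length_append]; omega⟩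

/-- One pass through the loop of `PushApart`. -/
theorem pushApartBody_spec (P : ShortestPathRule G) (h : R.Linked l r) {p q : Fin k}
    (hpq : p.1 + 1 = q.1) {m : ℕ} (hm : m = p.1 ∨ m = p.1 + 1 ∨ m = p.1 + 2)
    (hq : m = p.1 + 2 → R.left (l q) ≤ R.left (r q)) {U : Set V}
    (hU : ∀ v, v ∈ U ↔ ∀ i, i ≠ p → i ≠ q → v ∉ closedNbhd G (mixed l r m i))
    (S : List (V × V)) :
    ∃ x y T, R.pushApartBody P U (mixed l r m p, mixed l r m q, S) =
        (if T ≠ [] then Part.some (Sum.inr (x, y, S ++ T))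
          else Part.some (Sum.inl (x, y, S ++ T))) ∧
      R.Improves l r p q (mixed l r m) x y T (if m = p.1 + 1 then 0 else Fintype.card V) ∧
      (T = [] → x = mixed l r m p ∧ y = mixed l r m q) ∧
      (T = [] → m = p.1 + 1 → R.LeftStable l r p ∧ R.RightStable l r q) := by
  have hne : p ≠ q := by rintro rfl; omega
  set c := mixed l r m with hc
  have hs : R.Sorted c := h.sorted_mixed m
  -- the token at `p` is pushed to the left
  have hW₁ : ∀ v, v ∈ U \ closedNbhd G (c q) ↔ ∀ j, j ≠ p → v ∉ closedNbhd G (c j) := by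
    intro v
    rw [Set.mem_sdiff, hU]
    constructor
    · rintro ⟨h1, h2⟩ j hj
      by_cases hjq : j = q
      · rwa [hjq]
      · exact h1 j hj hjq
    · intro h1
      exact ⟨fun i hi _ => h1 i hi, h1 q hne.symm⟩
  obtain ⟨x, T₁, hpush₁, hpath₁, hmin⟩ := R.pushTokenLeft_spec P
    ((hW₁ (c p)).2 fun j hj => hs.notMem_closedNbhd hj.symm)
  -- Here the token at `q` stands at `r q`, the boundary of the region. For `m = p + 2` it stands at
  -- `l q`, whose neighbourhood may cut into the region.
  have hregion₁ : m ≠ p.1 + 2 → R.region l r p ⊆ U \ closedNbhd G (c q) := fun hm' v hv =>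
    (hW₁ v).2 fun j hj => h.notMem_closedNbhd_mixed hj (by omega) hv
  -- The push cannot cross the neighbouring tokens. The left one is a left record; the right one is
  -- `r q`, or `l q`, which by `hq` starts no later than `r q`.
  have hx : x ∈ reachSet G (R.region l r p) (l p) := by
    refine reachSet_trans (h.mixed_mem m p) (reachSet_subset_reachSet ?_ hpath₁.mem)
    intro v hv
    refine ⟨fun i hi => ?_, fun i hi => ?_⟩
    · have h1 : c i = l i := mixed_of_lt (by omega)
      rw [← h1]
      exact before_of_reach_right (fun z hz => (hW₁ z).1 hz i (by rintro rfl; omega))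
        (hs i p (by rw [Fin.lt_def]; omega)) hv
    · obtain rfl : i = q := Fin.ext (by omega)
      have h1 : R.Before v (c i) :=
        before_of_reach_left (fun z hz => (hW₁ z).1 hz i hne.symm)
          (hs p i (by rw [Fin.lt_def]; omega)) hv
      refine lt_of_lt_of_le h1 ?_
      by_cases hm' : m = p.1 + 2
      · rw [hc, mixed_of_lt (by omega)]; exact hq hm'
      · rw [hc, mixed_of_le (by omega)]
  have hxle : R.right x ≤ R.right (l p) := by
    apply hmin
    by_cases hm' : m = p.1 + 2
    · have h1 : c p = l p := mixed_of_lt (by omega)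
      rw [← h1]
      exact self_mem_reachSet (source_mem_of_mem_reachSet hpath₁.mem)
    · exact reachSet_mono (hregion₁ hm') (reachSet_symm (h.mixed_mem m p))
  have h₁ := h.update_left hx hxle
  set l₁ := Function.update l p x with hl₁
  -- The token at `q` has not moved yet, so it is still at `l q` precisely in the case `m = p + 2`.
  obtain ⟨m', hm', hc'⟩ : ∃ m', (m' = q.1 ∨ m' = q.1 + 1) ∧
      Function.update c p x = mixed l₁ r m' := by
    refine ⟨if m = p.1 + 2 then q.1 + 1 else q.1, by split_ifs <;> simp, ?_⟩
    ext i
    by_cases hi : i = p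
    · subst hi
      rw [Function.update_self, mixed_of_lt (by split_ifs <;> omega), hl₁, Function.update_self]
    · rw [Function.update_of_ne hi]
      have hi' : i.1 ≠ p.1 := fun h => hi (Fin.ext h)
      rcases Nat.lt_or_ge i.1 m with hlt | hlt
      · rw [hc, mixed_of_lt hlt, mixed_of_lt (by split_ifs <;> omega), hl₁,
          Function.update_of_ne hi]
      · rw [hc, mixed_of_le hlt, mixed_of_le (by split_ifs <;> omega)]
  -- the token at `q` is pushed to the right
  set c₁ := Function.update c p x with hc₁
  have hs₁ : R.Sorted c₁ := hc' ▸ h₁.sorted_mixed m'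
  have hcq : c₁ q = c q := Function.update_of_ne hne.symm _ _
  have hcp : c₁ p = x := Function.update_self ..
  have hW₂ : ∀ v, v ∈ U \ closedNbhd G x ↔ ∀ j, j ≠ q → v ∉ closedNbhd G (c₁ j) := by
    intro v
    rw [Set.mem_sdiff, hU]
    constructor
    · rintro ⟨h1, h2⟩ j hj
      by_cases hjp : j = p
      · rwa [hjp, hcp]
      · rw [hc₁, Function.update_of_ne hjp]; exact h1 j hjp hj
    · intro h1
      refine ⟨fun i hi hi' => ?_, hcp ▸ h1 p hne⟩
      have := h1 i hi'
      rwa [hc₁, Function.update_of_ne hi] at this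
  obtain ⟨y, T₂, hpush₂, hpath₂, hmax⟩ := R.pushTokenRight_spec P
    ((hW₂ (c₁ q)).2 fun j hj => hs₁.notMem_closedNbhd hj.symm)
  have hregion₂ : R.region l₁ r q ⊆ U \ closedNbhd G x := fun v hv =>
    (hW₂ v).2 fun j hj => hc' ▸ h₁.notMem_closedNbhd_mixed hj hm' hv
  have hmem₂ : c₁ q ∈ reachSet G (R.region l₁ r q) (l₁ q) := hc' ▸ h₁.mixed_mem m' q
  have hy : y ∈ reachSet G (R.region l₁ r q) (l₁ q) := by
    refine reachSet_trans hmem₂ (reachSet_subset_reachSet ?_ hpath₂.mem)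
    intro v hv
    refine ⟨fun i hi => ?_, fun i hi => ?_⟩
    · have h1 : c₁ i = l₁ i := by rw [hc']; exact mixed_of_lt (by omega)
      rw [← h1]
      exact before_of_reach_right (fun z hz => (hW₂ z).1 hz i (by rintro rfl; omega))
        (hs₁ i q (by rw [Fin.lt_def]; omega)) hv
    · have h1 : c₁ i = r i := by rw [hc']; exact mixed_of_le (by omega)
      rw [← h1]
      exact before_of_reach_left (fun z hz => (hW₂ z).1 hz i (by rintro rfl; omega))
        (hs₁ q i (by rw [Fin.lt_def]; omega)) hv
  have hyle : R.left (r q) ≤ R.left y :=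
    hmax _ (reachSet_mono hregion₂ (reachSet_trans (reachSet_symm hmem₂) (h₁ q)))
  have h₂ := h₁.update_right hy hyle
  -- the lengths
  have hlen₁ : T₁.length + Fintype.card V * R.potential l₁ r ≤
      Fintype.card V * R.potential l r + (if m = p.1 then Fintype.card V else 0) := by
    -- For `m = p` the token starts at `r p` and may have to walk to `l p` without improving
    -- anything. Otherwise it starts at `l p`, and any move improves the record.
    by_cases hmp : m = p.1
    · rw [if_pos hmp, add_comm]
      exact add_le_add (Nat.mul_le_mul_left _
        (potential_mono (right_update_le hxle) fun _ => le_rfl)) hpath₁.length_le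
    · rw [if_neg hmp, add_zero]
      have h1 : c p = l p := mixed_of_lt (by omega)
      by_cases hT : T₁ = []
      · rw [hT, List.length_nil, zero_add]
        exact Nat.mul_le_mul_left _ (potential_mono (right_update_le hxle) fun _ => le_rfl)
      · have hlt : R.potential l₁ r < R.potential l r := by
          refine potential_lt (right_update_le hxle) (fun _ => le_rfl) ⟨p, Or.inl ?_⟩
          rw [hl₁, Function.update_self, ← h1]
          exact fun h' => hT (hpath₁.nil_of_eq h')
        have h2 := Nat.mul_le_mul_left (Fintype.card V) (Nat.succ_le_of_lt hlt)
        rw [Nat.mul_succ] at h2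
        have := hpath₁.length_le
        omega
  have hlen₂ : T₂.length + Fintype.card V * R.potential l₁ (Function.update r q y) ≤
      Fintype.card V * R.potential l₁ r + (if m = p.1 + 2 then Fintype.card V else 0) := by
    by_cases hmp : m = p.1 + 2
    · rw [if_pos hmp, add_comm]
      exact add_le_add (Nat.mul_le_mul_left _
        (potential_mono (fun _ => le_rfl) (left_le_update hyle))) hpath₂.length_le
    · rw [if_neg hmp, add_zero]
      have h1 : c₁ q = r q := by rw [hcq]; exact mixed_of_le (by omega)
      by_cases hT : T₂ = []
      · rw [hT, List.length_nil, zero_add]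
        exact Nat.mul_le_mul_left _ (potential_mono (fun _ => le_rfl) (left_le_update hyle))
      · have hlt : R.potential l₁ (Function.update r q y) < R.potential l₁ r := by
          refine potential_lt (fun _ => le_rfl) (left_le_update hyle) ⟨q, Or.inr ?_⟩
          rw [Function.update_self, ← h1]
          exact fun h' => hT (hpath₂.nil_of_eq h')
        have h2 := Nat.mul_le_mul_left (Fintype.card V) (Nat.succ_le_of_lt hlt)
        rw [Nat.mul_succ] at h2
        have := hpath₂.length_le
        omega
  rw [hcq] at hpush₂
  have hnil : T₁ ++ T₂ = [] → x = c p ∧ y = c q := fun hT => by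
    rw [List.append_eq_nil_iff] at hT
    exact ⟨hpath₁.eq_of_nil hT.1, hcq ▸ hpath₂.eq_of_nil hT.2⟩
  refine ⟨x, y, T₁ ++ T₂, ?_, ⟨h₂, hxle, hyle, ?_, ?_⟩, hnil, ?_⟩
  · simp only [pushApartBody, hpush₁, hpush₂, Part.bind_some, List.append_assoc]
  · refine (hpath₁.isReconfSeq_tokens hs fun j hj v hv => (hW₁ v).1 hv j hj).append
      (hpath₂.isReconfSeq_tokens hs₁ fun j hj v hv => (hW₂ v).1 hv j hj)
  · rw [List.length_append, ← hl₁]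
    split_ifs at hlen₁ hlen₂ ⊢ <;> omega
  · intro hT hmp
    obtain ⟨hx', hy'⟩ := hnil hT
    have h1 : c p = l p := mixed_of_lt (by omega)
    have h2 : c q = r q := mixed_of_le (by omega)
    refine ⟨fun v hv => ?_, fun v hv => ?_⟩
    · rw [← h1, ← hx']
      exact hmin v (reachSet_mono (hregion₁ (by omega)) (h1.symm ▸ hv))
    · have h3 : l₁ = l := by rw [hl₁, hx', h1, Function.update_eq_self]
      rw [← h2, ← hy']
      rw [h3] at hregion₂
      refine hmax v (reachSet_mono hregion₂ (reachSet_trans (reachSet_symm ?_) hv))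
      rw [hcq, h2]
      exact h q

/-- With both tokens at their records, every nonempty pass lowers the potential, so the loop
terminates; the empty pass that ends it certifies stability. -/
theorem pushApart_loop (P : ShortestPathRule G) {p q : Fin k} (hpq : p.1 + 1 = q.1) {U : Set V}
    (h : R.Linked l r)
    (hU : ∀ v, v ∈ U ↔ ∀ i, i ≠ p → i ≠ q → v ∉ closedNbhd G (mixed l r (p.1 + 1) i))
    (S : List (V × V)) :
    ∃ x y T, (x, y, S ++ T) ∈ (R.pushApartBody P U).fix (l p, r q, S) ∧
      R.Improves l r p q (mixed l r (p.1 + 1)) x y T 0 ∧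
      R.LeftStable (Function.update l p x) (Function.update r q y) p ∧
      R.RightStable (Function.update l p x) (Function.update r q y) q := by
  induction hN : R.potential l r using Nat.strong_induction_on generalizing l r S with
  | _ N ih =>
  have hne : p ≠ q := by rintro rfl; omega
  have hp : mixed l r (p.1 + 1) p = l p := mixed_of_lt (by omega)
  have hq : mixed l r (p.1 + 1) q = r q := mixed_of_le (by omega)
  obtain ⟨x, y, T, hbody, himp, hnil, hstab⟩ := pushApartBody_spec P h hpq (m := p.1 + 1)
    (by omega) (by omega) hU S
  rw [hp, hq] at hbody hnil
  rw [if_pos rfl] at himp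
  by_cases hT : T = []
  · obtain ⟨rfl, rfl⟩ := hnil hT
    refine ⟨_, _, T, PFun.mem_fix_iff.2 (Or.inl ?_), himp, ?_⟩
    · rw [hbody, if_neg (by simpa using hT)]
      exact Part.mem_some _
    · rw [Function.update_eq_self, Function.update_eq_self]
      exact hstab hT rfl
  · have hmix := mixed_update_update (l := l) (r := r) hpq (Or.inr (Or.inl rfl)) x y
    have hlt : R.potential (Function.update l p x) (Function.update r q y) < N := by
      have h1 := himp.length_le
      have h2 : 0 < T.length := List.length_pos_iff.2 hT
      rw [← hN]
      -- With budget 0, a nonempty `T` forces a strict drop of the potential.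
      exact Nat.lt_of_mul_lt_mul_left (a := Fintype.card V) (by omega)
    obtain ⟨x', y', T', hfix, himp', hstab'⟩ := ih _ hlt himp.linked (by
      intro v
      rw [hU, ← hmix]
      refine forall_congr' fun i => forall_congr' fun hi => forall_congr' fun hi' => ?_
      rw [Function.update_of_ne hi', Function.update_of_ne hi]) (S ++ T) rfl
    rw [← hmix] at himp'
    rw [Function.update_self, Function.update_self] at hfix
    refine ⟨x', y', T ++ T', PFun.mem_fix_iff.2 (Or.inr ⟨(x, y, S ++ T), ?_, ?_⟩),
      himp.trans himp', ?_⟩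
    · rw [hbody, if_pos hT]
      exact Part.mem_some _
    · rwa [← List.append_assoc]
    · simpa only [Function.update_idem] using hstab'

/-- Only the first pass may start away from the records; afterwards the configuration is the mixture
at `p + 1` and `pushApart_loop` applies. -/
theorem pushApart_spec (P : ShortestPathRule G) (h : R.Linked l r) {p q : Fin k}
    (hpq : p.1 + 1 = q.1) {m : ℕ} (hm : m = p.1 ∨ m = p.1 + 1 ∨ m = p.1 + 2)
    (hq : m = p.1 + 2 → R.left (l q) ≤ R.left (r q)) :
    ∃ x y T, R.pushApart P {v | ∀ i, i ≠ p → i ≠ q → v ∉ closedNbhd G (mixed l r m i)}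
        (mixed l r m p) (mixed l r m q) = Part.some (x, y, T) ∧
      R.Improves l r p q (mixed l r m) x y T (Fintype.card V) ∧
      R.LeftStable (Function.update l p x) (Function.update r q y) p ∧
      R.RightStable (Function.update l p x) (Function.update r q y) q := by
  have hne : p ≠ q := by rintro rfl; omega
  set U := {v | ∀ i, i ≠ p → i ≠ q → v ∉ closedNbhd G (mixed l r m i)} with hU
  obtain ⟨x, y, T, hbody, himp, hnil, -⟩ := pushApartBody_spec P h hpq hm hq
    (U := U) (fun v => Iff.rfl) []
  have hmix := mixed_update_update (l := l) (r := r) hpq hm x y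
  have hU' : ∀ v, v ∈ U ↔ ∀ i, i ≠ p → i ≠ q → v ∉ closedNbhd G
      (mixed (Function.update l p x) (Function.update r q y) (p.1 + 1) i) := by
    intro v
    rw [hU, ← hmix]
    refine forall_congr' fun i => forall_congr' fun hi => forall_congr' fun hi' => ?_
    rw [Function.update_of_ne hi', Function.update_of_ne hi]
  obtain ⟨x', y', T', hfix, himp', hstab'⟩ := pushApart_loop P hpq himp.linked hU' T
  rw [← hmix] at himp'
  rw [Function.update_self, Function.update_self] at hfix
  refine ⟨x', y', T ++ T', Part.eq_some_iff.2 ?_, ?_, ?_⟩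
  -- A first pass without moves does not yield stability when `m ≠ p + 1`. But the tokens then stand
  -- at the updated records, so the run analysed from there is the original run itself.
  · by_cases hT : T = []
    · obtain ⟨hx, hy⟩ := hnil hT
      rw [hT] at hfix ⊢
      rwa [hx, hy] at hfix
    · refine PFun.mem_fix_iff.2 (Or.inr ⟨(x, y, [] ++ T), ?_, hfix⟩)
      rw [hbody, if_pos hT]
      exact Part.mem_some _
  · have := himp.trans himp'
    refine ⟨this.1, this.2, this.3, this.4, this.5.trans ?_⟩
    gcongr
    split_ifs
    · exact Nat.zero_le _
    · exact le_rfl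
  · simpa only [Function.update_idem] using hstab'

end PushApart

/-! ### Components and extremes -/

section Component

variable {V : Type*} {G : SimpleGraph V} {R : DistinctRep G} {k : ℕ}

theorem isExLeft_unique {C : Set (IndepSets G k)} {j : Fin k} {v w : V}
    (hv : R.IsExLeft C j v) (hw : R.IsExLeft C j w) : v = w := by
  obtain ⟨⟨A, hA, rfl⟩, h1⟩ := hv
  obtain ⟨⟨B, hB, rfl⟩, h2⟩ := hw
  exact R.right_injective (le_antisymm (h1 B hB) (h2 A hA))

theorem isExRight_unique {C : Set (IndepSets G k)} {j : Fin k} {v w : V}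
    (hv : R.IsExRight C j v) (hw : R.IsExRight C j w) : v = w := by
  obtain ⟨⟨A, hA, rfl⟩, h1⟩ := hv
  obtain ⟨⟨B, hB, rfl⟩, h2⟩ := hw
  exact R.left_injective (le_antisymm (h2 A hA) (h1 B hB))

theorem mem_component_iff [DecidableEq V] {A B : IndepSets G k} :
    B ∈ component G A ↔ (reconfGraph G k).Reachable A B := by
  rw [component, SimpleGraph.ConnectedComponent.mem_supp_iff, SimpleGraph.ConnectedComponent.eq]
  exact ⟨fun h => h.symm, fun h => h.symm⟩

theorem component_eq_of_reachable [DecidableEq V] {A B : IndepSets G k}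
    (h : (reconfGraph G k).Reachable A B) :
    component G A = component G B := by
  rw [component, component, SimpleGraph.ConnectedComponent.sound h]

end Component

/-! ### The main loop -/

section Reconfigure

variable {V : Type*} [Fintype V] [DecidableEq V] {G : SimpleGraph V} {R : DistinctRep G} {k : ℕ}

/-- The invariant of the main loop: the current configuration has left extremes at the first `m`
positions and right extremes at the others, and the extremes to the left of the current position
cannot be improved. -/
structure LoopInvariant (R : DistinctRep G) (s : State V k) (m : ℕ) : Prop where
  linked : R.Linked s.lext s.rext
  a_eq : s.a = mixed s.lext s.rext m
  lt : s.j < k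
  position : m = s.j ∨ m = s.j + 2 ∧ m ≤ k ∧
    ∀ q : Fin k, q.1 = s.j + 1 → R.left (s.lext q) ≤ R.left (s.rext q)
  leftStable : ∀ i : Fin k, i.1 < s.j → R.LeftStable s.lext s.rext i
  rightStable : ∀ i : Fin k, 0 < i.1 → i.1 ≤ s.j → R.RightStable s.lext s.rext i

/-- One pass through the main loop preserves the invariant. -/
theorem LoopInvariant.step (P : ShortestPathRule G) {s : State V k} {m : ℕ}
    (h : R.LoopInvariant s m) (hj : s.j + 1 < k) :
    ∃ (s' : State V k) (m' : ℕ) (T : List (V × V)),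
      R.reconfigureBody P k s = Part.some (Sum.inr s') ∧ R.LoopInvariant s' m' ∧
      s'.S = s.S ++ T ∧ IsReconfSeq G (tokens s.a) T (tokens s'.a) ∧
      3 * R.potential s'.lext s'.rext + (k - 1 - s'.j) <
        3 * R.potential s.lext s.rext + (k - 1 - s.j) ∧
      T.length + Fintype.card V * (3 * R.potential s'.lext s'.rext + (k - 1 - s'.j)) ≤
        Fintype.card V * (3 * R.potential s.lext s.rext + (k - 1 - s.j)) := by
  obtain ⟨a, l, r, j, S⟩ := s
  obtain ⟨hlink, hconf, -, hm, hL, hR⟩ := h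
  simp only at hlink hconf hm hL hR hj ⊢
  subst hconf
  let p : Fin k := ⟨j, by omega⟩
  let q : Fin k := ⟨j + 1, hj⟩
  have hpq : p.1 + 1 = q.1 := rfl
  obtain ⟨x, y, T, hpush, himp, hLp, hRq⟩ := pushApart_spec P hlink hpq (m := m)
    (hm.imp id fun h => Or.inr h.1)
    (fun hm' => hm.elim (fun h => absurd (h.symm.trans hm') (by simp [p])) fun h => h.2.2 q rfl)
  have hmix := mixed_update_update (l := l) (r := r) hpq
    (hm.imp id fun h => Or.inr h.1) x y
  have hlen := himp.length_le
  have hseq := himp.isReconfSeq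
  by_cases hch : (x, y) ≠ (l p, r q)
  · have hlt : R.potential (Function.update l p x) (Function.update r q y) <
        R.potential l r := by
      refine potential_lt (right_update_le himp.right_le) (left_le_update himp.left_le) ?_
      by_contra hn
      push Not at hn
      have h1 := (hn p).1
      have h2 := (hn q).2
      rw [Function.update_self] at h1 h2
      exact hch (Prod.ext h1 h2)
    refine ⟨⟨Function.update (Function.update (mixed l r m) p x) q y, Function.update l p x, Function.update r q y,
      if 0 < j then j - 1 else j + 1, S ++ T⟩, j + 1, T, ?_, ⟨himp.linked, hmix, ?_, ?_, ?_, ?_⟩,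
      rfl, hseq, ?_, ?_⟩
    · simp only [reconfigureBody, dif_pos hj]
      erw [hpush]
      rw [Part.bind_some, if_pos hch]
    · simp only
      split_ifs <;> omega
    · simp only
      split_ifs with h0
      -- After stepping back, the mixture at `j + 1` is the one at two past the new index, and the
      -- new `q` is the old `p`.
      · refine Or.inr ⟨by omega, by omega, fun i hi => ?_⟩
        obtain rfl : i = p := Fin.ext (by simp only [p]; omega)
        have hold := hR p h0 le_rfl
        have hpne : p ≠ q := by rintro h; have := congrArg Fin.val h; omega
        have hright : R.right x ≤ R.right (r p) := by
          have := hLp _ (himp.linked p)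
          rwa [Function.update_self, Function.update_of_ne hpne] at this
        rw [Function.update_self, Function.update_of_ne hpne]
        -- Otherwise the interval of `x` would be nested in that of `r p` with a larger left end.
        -- Then `x` is adjacent to `r p` and lies in the old region, so `r p` was not right stable.
        by_contra hcon
        rw [not_le] at hcon
        have hadj : G.Adj (r p) x := by
          refine (R.adj_iff_le _ _).2 ⟨?_, ?_, ?_⟩
          · rintro rfl; exact lt_irrefl _ hcon
          · exact hcon.le.trans (R.left_le_right x)
          · exact (R.left_le_right x).trans hright
        have hreg := hlink.right_mem p
        refine absurd (hold x (reachSet_step (hlink p) hadj ⟨fun i hi => ?_, fun i hi => ?_⟩))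
          (not_le.2 hcon)
        · exact lt_trans (hreg.1 i hi) hcon
        · exact lt_of_le_of_lt hright (hreg.2 i hi)
      · exact Or.inl rfl
    · intro i hi
      simp only at hi ⊢
      split_ifs at hi with h0
      -- The region of `i` depends only on `l (i-1)` and `r (i+1)`, so the new `l p` and `r q` alter
      -- only the regions of `q` and `p`. Stability further left persists, and stepping back by one
      -- suffices.
      · have hreg : R.region (Function.update l p x) (Function.update r q y) i =
            R.region l r i := region_congr
          (fun h hh => Function.update_of_ne (by rintro rfl; simp only [p] at hh; omega) _ _)
          (fun h hh => Function.update_of_ne (by rintro rfl; simp only [q] at hh; omega) _ _)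
        have hip : i ≠ p := by rintro rfl; simp only [p] at hi; omega
        have := hL i (by omega)
        rwa [LeftStable, hreg, Function.update_of_ne hip]
      · obtain rfl : i = p := Fin.ext (by simp only [p]; omega)
        exact hLp
    · intro i hi0 hi
      simp only at hi ⊢
      split_ifs at hi with h0
      · have hreg : R.region (Function.update l p x) (Function.update r q y) i =
            R.region l r i := region_congr
          (fun h hh => Function.update_of_ne (by rintro rfl; simp only [p] at hh; omega) _ _)
          (fun h hh => Function.update_of_ne (by rintro rfl; simp only [q] at hh; omega) _ _)
        have hip : i ≠ p := by rintro rfl; simp only [p] at hi; omega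
        have hiq : i ≠ q := by rintro rfl; simp only [q] at hi; omega
        have := hR i hi0 (by omega)
        rwa [RightStable, hreg, Function.update_of_ne hip, Function.update_of_ne hiq]
      · obtain rfl : i = q := Fin.ext (by simp only [q]; omega)
        exact hRq
    · simp only
      split_ifs <;> omega
    · simp only
      generalize R.potential (Function.update l p x) (Function.update r q y) = Φ' at *
      generalize R.potential l r = Φ at *
      -- The origin of the factor 3: one unit of the drop of Φ pays for the improving moves, the
      -- other two for the n unpaid moves and for the possible step back of the index.
      have h1 : k - 1 - (if 0 < j then j - 1 else j + 1) ≤ k - 1 - j + 1 := by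
        split_ifs <;> omega
      have h2 : 2 * Φ' + 2 ≤ 2 * Φ := by omega
      have h3 := Nat.mul_le_mul_left (Fintype.card V) h1
      have h4 := Nat.mul_le_mul_left (Fintype.card V) h2
      simp only [Nat.mul_add, Nat.mul_left_comm _ 2, Nat.mul_left_comm _ 3, Nat.mul_one] at h3 h4 ⊢
      omega
  · rw [not_not] at hch
    obtain ⟨rfl, rfl⟩ := Prod.mk.inj hch
    simp only [Function.update_eq_self] at hLp hRq hlen
    refine ⟨⟨Function.update (Function.update (mixed l r m) p (l p)) q (r q), l, r, j + 1, S ++ T⟩,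
      j + 1, T, ?_, ⟨hlink, ?_, ?_, ?_, ?_, ?_⟩,
      rfl, hseq, ?_, ?_⟩
    · simp only [reconfigureBody, dif_pos hj]
      erw [hpush]
      rw [Part.bind_some, if_neg (not_not.2 rfl)]
    · simpa only [Function.update_eq_self] using hmix
    · exact hj
    · exact Or.inl rfl
    · intro i hi
      simp only at hi
      rcases Nat.lt_or_ge i.1 j with hlt | hge
      · exact hL i hlt
      · obtain rfl : i = p := Fin.ext (by simp only [p]; omega)
        exact hLp
    · intro i hi0 hi
      simp only at hi
      rcases Nat.lt_or_ge j i.1 with hlt | hge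
      · obtain rfl : i = q := Fin.ext (by simp only [q]; omega)
        exact hRq
      · exact hR i hi0 hge
    · simp only; omega
    · simp only
      -- Without improvement the potential is unchanged, and the advance of the index pays for the
      -- at most n moves.
      have h1 : k - 1 - j = (k - 1 - (j + 1)) + 1 := by omega
      rw [h1, ← add_assoc, Nat.mul_succ]
      omega

theorem reconfigure_loop (P : ShortestPathRule G) {s : State V k} {m : ℕ}
    (h : R.LoopInvariant s m) :
    ∃ (l r : Fin k → V) (T : List (V × V)),
      (mixed l r (k - 1), s.S ++ T) ∈ (R.reconfigureBody P k).fix s ∧ R.Linked l r ∧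
      (∀ i : Fin k, i.1 + 1 < k → R.LeftStable l r i) ∧
      (∀ i : Fin k, 0 < i.1 → R.RightStable l r i) ∧
      IsReconfSeq G (tokens s.a) T (tokens (mixed l r (k - 1))) ∧
      T.length ≤ Fintype.card V * (3 * R.potential s.lext s.rext + (k - 1 - s.j)) := by
  induction hN : 3 * R.potential s.lext s.rext + (k - 1 - s.j) using Nat.strong_induction_on
    generalizing s m with
  | _ N ih =>
  by_cases hj : s.j + 1 < k
  · obtain ⟨s', m', T, hbody, hinv, hS, hseq, hlt, hlen⟩ := h.step P hj
    obtain ⟨l, r, T', hfix, hlink, hL, hR, hseq', hlen'⟩ := ih _ (hN ▸ hlt) hinv rfl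
    refine ⟨l, r, T ++ T', PFun.mem_fix_iff.2 (Or.inr ⟨s', ?_, ?_⟩), hlink, hL, hR,
      hseq.append hseq', ?_⟩
    · rw [hbody]; exact Part.mem_some _
    · rwa [← List.append_assoc, ← hS]
    · rw [List.length_append, ← hN]
      omega
  · have hjk := h.lt
    -- At the end `j = k - 1`, and `m ≤ k` excludes `m = j + 2`.
    have hm : m = k - 1 := by
      rcases h.position with h | h <;> omega
    refine ⟨s.lext, s.rext, [], PFun.mem_fix_iff.2 (Or.inl ?_), h.linked,
      fun i hi => h.leftStable i (by omega), fun i hi => h.rightStable i hi (by omega), ?_, ?_⟩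
    · rw [reconfigureBody, dif_neg hj, List.append_nil, ← hm, ← h.a_eq]
      exact Part.mem_some _
    · rw [h.a_eq, hm]; rfl
    · exact Nat.zero_le _

/-- `Reconfigure` finds the extreme set of a component by a short reconfiguration sequence. -/
theorem reconfigure_spec (R : DistinctRep G) (P : ShortestPathRule G) (hk : 2 ≤ k)
    (A : IndepSets G k) :
    ∃ (X : IndepSets G k) (S : List (V × V)),
      (R.proj X, S) ∈ R.reconfigure P A ∧
      (X.1 : Set V) = R.extremeSet (k - 1) (component G A) ∧
      IsReconfSeq G A.1 S X.1 ∧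
      S.length ≤ 8 * k * Fintype.card V ^ 2 + 2 * k * Fintype.card V := by
  have hs := R.sorted_proj A
  have hinit : R.LoopInvariant ⟨R.proj A, R.proj A, R.proj A, 0, []⟩ 0 := by
    refine ⟨?_, ?_, by simp only; omega, Or.inl rfl, ?_, ?_⟩
    · intro i
      refine self_mem_reachSet ⟨fun h hh => hs _ _ ?_, fun h hh => hs _ _ ?_⟩ <;>
        · rw [Fin.lt_def]; omega
    · ext i; simp [mixed]
    · intro i hi; simp at hi
    · intro i hi hi'; simp only at hi'; omega
  obtain ⟨l, r, T, hfix, hlink, hL, hR, hseq, hlen⟩ := reconfigure_loop P hinit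
  have hsort := hlink.sorted_mixed (k - 1)
  let X : IndepSets G k := ⟨tokens (mixed l r (k - 1)), isNIndepSet_tokens hsort⟩
  have hX : R.proj X = mixed l r (k - 1) := proj_eq_of_sorted hsort rfl
  simp only [tokens_proj] at hseq
  have hAX : (reconfGraph G k).Reachable A X := ⟨(hseq.exists_walk A X).choose⟩
  have hXC : X ∈ component G A := mem_component_iff.2 hAX
  have hmem : ∀ B ∈ component G A, ∀ i, R.proj B i ∈ reachSet G (R.region l r i) (l i) := by
    intro B hB i
    refine proj_mem_of_reachable hL hR (A := X) ?_ (hAX.symm.trans (mem_component_iff.1 hB)) i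
    intro i
    rw [hX]
    exact hlink.mixed_mem _ i
  have hexl : ∀ i : Fin k, i.1 < k - 1 → R.IsExLeft (component G A) i (R.proj X i) := by
    intro i hi
    refine ⟨⟨X, hXC, rfl⟩, fun B hB => ?_⟩
    rw [hX, mixed_of_lt hi]
    exact hL i (by omega) _ (hmem B hB i)
  have hexr : ∀ i : Fin k, k - 1 ≤ i.1 → R.IsExRight (component G A) i (R.proj X i) := by
    intro i hi
    refine ⟨⟨X, hXC, rfl⟩, fun B hB => ?_⟩
    rw [hX, mixed_of_le hi]
    exact hR i (by omega) _ (hmem B hB i)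
  refine ⟨X, T, ?_, ?_, hseq, ?_⟩
  · rw [hX]; exact hfix
  · ext v
    rw [← R.tokens_proj X, Finset.mem_coe, mem_tokens]
    constructor
    · rintro ⟨i, rfl⟩
      exact ⟨i, (Nat.lt_or_ge i.1 (k - 1)).imp (fun h => ⟨h, hexl i h⟩) fun h => ⟨h, hexr i h⟩⟩
    · rintro ⟨i, ⟨h, hv⟩ | ⟨h, hv⟩⟩
      · exact ⟨i, isExLeft_unique (hexl i h) hv⟩
      · exact ⟨i, isExRight_unique (hexr i h) hv⟩
  · refine hlen.trans ?_
    have h1 := R.potential_le (R.proj A) (R.proj A)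
    -- With Φ ≤ 2kn this gives 6kn² + kn, within the claimed bound.
    calc Fintype.card V * (3 * R.potential (R.proj A) (R.proj A) + (k - 1 - 0))
        ≤ Fintype.card V * (3 * (k * (2 * Fintype.card V)) + k) := by
          gcongr
          omega
      _ ≤ 8 * k * Fintype.card V ^ 2 + 2 * k * Fintype.card V := by nlinarith

theorem reachable_of_extremeSet_eq (R : DistinctRep G) (hk : 1 ≤ k) (A B : IndepSets G k)
    (h : R.extremeSet (k - 1) (component G A) = R.extremeSet (k - 1) (component G B)) :
    (reconfGraph G k).Reachable A B := by
  rcases hk.lt_or_eq with hk | rfl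
  · obtain ⟨P⟩ : Nonempty (ShortestPathRule G) := inferInstance
    obtain ⟨X, S, -, hX, hS, -⟩ := R.reconfigure_spec P hk A
    obtain ⟨Y, T, -, hY, hT, -⟩ := R.reconfigure_spec P hk B
    obtain rfl : X = Y := Subtype.ext (Finset.coe_injective (hX.trans (h.trans hY.symm)))
    exact SimpleGraph.Reachable.trans ⟨(hS.exists_walk A X).choose⟩
      (SimpleGraph.Reachable.symm ⟨(hT.exists_walk B X).choose⟩)
  -- For `k = 1` the extreme set holds just the right extreme, and a single token's vertex
  -- determines the whole configuration; so the components share a member.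
  · obtain ⟨C, hC, hmax⟩ := Set.exists_max_image (component G A)
      (fun C => R.left (R.proj C 0)) (Set.toFinite _) ⟨A, mem_component_iff.2 (.refl _)⟩
    have hv : R.proj C 0 ∈ R.extremeSet (1 - 1) (component G A) :=
      ⟨0, Or.inr ⟨Nat.zero_le _, ⟨C, hC, rfl⟩, hmax⟩⟩
    rw [h] at hv
    obtain ⟨i, ⟨hi, -⟩ | ⟨-, ⟨D, hD, hDC⟩, -⟩⟩ := hv
    · omega
    · obtain rfl : C = D := by
        apply Subtype.ext
        rw [← R.tokens_proj C, ← R.tokens_proj D]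
        congr 1
        ext j
        rw [Subsingleton.elim j 0, ← hDC, Subsingleton.elim i 0]
      exact (mem_component_iff.1 hC).trans (mem_component_iff.1 hD).symm

theorem exists_short_isReconfSeq (R : DistinctRep G) (hk : 1 ≤ k) {A B : IndepSets G k}
    (h : (reconfGraph G k).Reachable A B) :
    ∃ S : List (V × V), IsReconfSeq G A.1 S B.1 ∧
      S.length ≤ 2 * (8 * k * Fintype.card V ^ 2 + 2 * k * Fintype.card V) := by
  rcases hk.lt_or_eq with hk | rfl
  · obtain ⟨P⟩ : Nonempty (ShortestPathRule G) := inferInstance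
    obtain ⟨X, S, -, hX, hS, hSl⟩ := R.reconfigure_spec P hk A
    obtain ⟨Y, T, -, hY, hT, hTl⟩ := R.reconfigure_spec P hk B
    rw [← component_eq_of_reachable h] at hY
    obtain rfl : X = Y := Subtype.ext (Finset.coe_injective (hX.trans hY.symm))
    obtain ⟨w, hw⟩ := hS.exists_walk A X
    obtain ⟨w', hw'⟩ := hT.exists_walk B X
    obtain ⟨Q, hQ, hQl⟩ := exists_isReconfSeq_of_walk (w.append w'.reverse)
    refine ⟨Q, hQ, ?_⟩
    rw [hQl, SimpleGraph.Walk.length_append, SimpleGraph.Walk.length_reverse, hw, hw']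
    omega
  · classical
    obtain ⟨w⟩ := h
    obtain ⟨S, hS, hl⟩ := exists_isReconfSeq_of_walk w.bypass
    refine ⟨S, hS, ?_⟩
    have hlt := w.bypass_isPath.length_lt
    -- One-token configurations correspond to vertices, so a path in `R_1(G)` has fewer than n
    -- moves.
    have hcard : Fintype.card (IndepSets G 1) ≤ Fintype.card V := by
      refine Fintype.card_le_of_injective (fun C => R.proj C 0) fun C D hCD => ?_
      apply Subtype.ext
      rw [← R.tokens_proj C, ← R.tokens_proj D]
      congr 1
      ext j
      rw [Subsingleton.elim j 0]
      exact hCD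
    rw [hl]
    nlinarith [sq_nonneg (Fintype.card V)]

end Reconfigure

end DistinctRep

end

end TokenSliding

/-! ### The main theorem -/

theorem mainTheorem1 {V : Type*} [Fintype V] [DecidableEq V] (G : SimpleGraph V)
    (hG : TokenSliding.IsIntervalGraph G) (k : ℕ) (hk : 1 ≤ k) :
    -- `G` has an interval representation with distinct endpoints
    Nonempty (TokenSliding.DistinctRep G) ∧
    -- for any such representation, `Reconfigure` is correct and its sequence is short
    (2 ≤ k → ∀ (R : TokenSliding.DistinctRep G) (P : TokenSliding.ShortestPathRule G)
      (A : TokenSliding.IndepSets G k),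
      ∃ (X : TokenSliding.IndepSets G k) (S : List (V × V)),
        (R.proj X, S) ∈ R.reconfigure P A ∧
        (X.1 : Set V) = R.extremeSet (k - 1) (TokenSliding.component G A) ∧
        TokenSliding.IsReconfSeq G A.1 S X.1 ∧
        S.length ≤ 8 * k * Fintype.card V ^ 2 + 2 * k * Fintype.card V) ∧
    -- two independent sets are reconfigurable iff their extreme sets coincide
    (∀ (R : TokenSliding.DistinctRep G) (A B : TokenSliding.IndepSets G k),
      (TokenSliding.reconfGraph G k).Reachable A B ↔
        R.extremeSet (k - 1) (TokenSliding.component G A) =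
          R.extremeSet (k - 1) (TokenSliding.component G B)) ∧
    -- and then a sequence of length `O(k n ^ 2)` connects them
    (∀ A B : TokenSliding.IndepSets G k, (TokenSliding.reconfGraph G k).Reachable A B →
      ∃ S : List (V × V), TokenSliding.IsReconfSeq G A.1 S B.1 ∧
        S.length ≤ 2 * (8 * k * Fintype.card V ^ 2 + 2 * k * Fintype.card V)) := by
  have hR : Nonempty (TokenSliding.DistinctRep G) := by
    obtain ⟨R⟩ := hG
    exact R.nonempty_distinctRep
  refine ⟨hR, fun hk' R P A => R.reconfigure_spec P hk' A, fun R A B => ⟨fun h => ?_, ?_⟩, ?_⟩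
  · rw [TokenSliding.DistinctRep.component_eq_of_reachable h]
  · exact R.reachable_of_extremeSet_eq hk A B
  · obtain ⟨R⟩ := hR
    exact fun A B h => R.exists_short_isReconfSeq hk h
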